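/- **Setting.** Let $p\ge 5$ be a prime, $\mathrm G_{\mathbb Q}=\mathrm{Gal}(\overline{\mathbb Q}/\mathbb Q)$, $\chi$ the $p$-adic cyclotomic character and $\bar\chi$ its reduction modulo $p$. Let $\bar\rho=\begin{pmatrix}\varphi & *\\ 0& 1\end{pmatrix}:\mathrm G_{\mathbb Q}\to \mathrm{GL}_2(\mathbb F_p)$ be a representation with $\varphi=\bar\chi\beta^2$ for a continuous character $\beta:\mathrm G_{\mathbb Q}\to\mathbb F_p^\times$, and let $\rho:\mathrm G_{\mathbb Q}\to \mathrm{GL}_2(\mathbb Z_p)$ be a continuous homomorphism lifting $\bar\rho$. Let $\tilde\beta$ be the Teichmüller lift of $\beta$ and $\psi=\tilde\beta^{-1}$. Let $T=\mathbb Z_pe_1\oplus\mathbb Z_pe_2$ be the Galois module of $\rho\otimes\psi$, $V=T\otimes\mathbb Q_p$, and let $T'=\mathbb Z_p\,p^{-1}e_1\oplus\mathbb Z_pe_2\subset V$, which is also Galois stable. Put $A=V/T$ and $A'=V/T'$. **The invariant $\delta_\ell$.** Let $\ell\ne p$ be a prime; fix an embedding $\overline{\mathbb Q}\hookrightarrow\overline{\mathbb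 Q}_\ell$, write $\mathrm G_\ell=\mathrm{Gal}(\overline{\mathbb Q}_\ell/\mathbb Q_\ell)$, let $\mathrm I_\ell\subset \mathrm G_\ell$ be the inertia group, and write $(\cdot)_{|\ell}$ for restriction to $\mathrm G_\ell$. For a finite extension $K$ of $\mathbb Q_\ell$ with inertia group $\mathrm I_K$ and $M\in\{V,A,A'\}$ put $H^1_{\mathrm{nr}}(K,M)=\ker\big(H^1(K,M)\to H^1(\mathrm I_K,M)\big)$ (continuous cohomology). For $B\in\{A,A'\}$ let $H^1_f(\mathbb Q_\ell,B)$ be the image of $H^1_{\mathrm{nr}}(\mathbb Q_\ell,V)$ in $H^1(\mathbb Q_\ell,B)$. Let $\mathbb Q_\infty=\bigcup_n\mathbb Q_n$ be the cyclotomic $\mathbb Z_p$-extension of $\mathbb Q$ with layers $\mathbb Q_n$, and $\Gamma=\mathrm{Gal}(\mathbb Q_\infty/\mathbb Q)$. Put $$J_\ell^{\mathrm{BK}}(B/\mathbb Q)=\frac{H^1(\mathbb Q_\ell,B)}{H^1_f(\mathbb Q_\ell,B)},\qquad J_\ell^{\mathrm{Gr}}(B/\mathbb Q_n)=\bigoplus_{v\mid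 \ell}\frac{H^1(\mathbb Q_{n,v},B)}{H^1_{\mathrm{nr}}(\mathbb Q_{n,v},B)},\qquad J_\ell^{\mathrm{Gr}}(B/\mathbb Q_\infty)=\varinjlim_n J_\ell^{\mathrm{Gr}}(B/\mathbb Q_n),$$ with $v$ running over the places of $\mathbb Q_n$ above $\ell$ and with restriction maps as transition maps. Let $h_{\ell,B}:J_\ell^{\mathrm{BK}}(B/\mathbb Q)\to J_\ell^{\mathrm{Gr}}(B/\mathbb Q)\to J_\ell^{\mathrm{Gr}}(B/\mathbb Q_\infty)^\Gamma$ be the composite of the natural maps, and $\delta_\ell(B)=\dim_{\mathbb F_p}(\ker h_{\ell,B})[p]$. **Trivial primes and Type III.** A prime $\ell$ is *trivial* if $\ell\equiv 1\pmod p$, $\ell\not\equiv 1\pmod{p^2}$ and $\bar\rho_{|\ell}$ is trivial. Fix an arithmetic Frobenius $\sigma_\ell\in\mathrm G_\ell$ and $\tau_\ell\in\mathrm I_\ell$ whose image topologically generates the maximal pro-$p$ quotient of $\mathrm I_\ell$. A homomorphism $\varrho:\mathrm G_\ell\to\mathrm{GL}_2(\mathbb Z_p)$ *satisfies* $\mathcal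 D_\ell^{\mathrm{ram}}$ if, after conjugation by some matrix in $\ker\big(\mathrm{GL}_2(\mathbb Z_p)\to\mathrm{GL}_2(\mathbb F_p)\big)$, $$\varrho(\sigma_\ell)=\begin{pmatrix}\ell&x\\0&1\end{pmatrix},\qquad \varrho(\tau_\ell)=\begin{pmatrix}1&y\\0&1\end{pmatrix}\qquad\text{with } p^2\mid x \text{ and } p\,\|\,y .$$ It *satisfies the Type III condition* if it is the conjugate $\begin{pmatrix}0&1\\1&1\end{pmatrix}\varrho'\begin{pmatrix}0&1\\1&1\end{pmatrix}^{-1}$ of some $\varrho'$ satisfying $\mathcal D_\ell^{\mathrm{ram}}$. **Statement.** Let $\ell$ be a trivial prime such that $\rho_{|\ell}$ satisfies the Type III condition. Then $\delta_\ell(A')=0$. If moreover $\beta_{|\ell}=1$, then $\delta_\ell(A)=1$ and $H^0(\mathbb Q_\ell,A)$ is finite. -/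

import Mathlib

open scoped NumberField

noncomputable section

namespace TypeThree

/-! ## Continuous cohomology in degree one -/

section Cohomology

variable {k G M N : Type*} [CommRing k] [Group G] [TopologicalSpace G]
  [AddCommGroup M] [Module k M] [TopologicalSpace M] [IsTopologicalAddGroup M]
  [ContinuousConstSMul k M]
  [AddCommGroup N] [Module k N] [TopologicalSpace N] [IsTopologicalAddGroup N]
  [ContinuousConstSMul k N]

/-- Continuous 1-cocycles (crossed homomorphisms) of a subgroup `U` of `G` with values in a
topological `G`-module. -/
def Z1 (π : Representation k G M) (U : Subgroup G) : Submodule k (U → M) where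
  carrier := {c | Continuous c ∧ ∀ g h : U, c (g * h) = c g + π g (c h)}
  add_mem' := by
    rintro a b ⟨ha, ha'⟩ ⟨hb, hb'⟩
    refine ⟨ha.add hb, fun g h => ?_⟩
    simp only [Pi.add_apply, ha', hb', map_add]
    abel
  zero_mem' := ⟨continuous_const, fun g h => by simp⟩
  smul_mem' := by
    rintro r a ⟨ha, ha'⟩
    refine ⟨ha.const_smul r, fun g h => ?_⟩
    simp only [Pi.smul_apply, ha', map_smul, smul_add]

/-- The cocycles which are principal crossed homomorphisms `g ↦ g m - m`. -/
def B1 (π : Representation k G M) (U : Subgroup G) : Submodule k (Z1 π U) where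
  carrier := {c | ∃ m : M, ∀ g : U, c.1 g = π g m - m}
  add_mem' := by
    rintro a b ⟨m, hm⟩ ⟨n, hn⟩
    refine ⟨m + n, fun g => ?_⟩
    simp only [Submodule.coe_add, Pi.add_apply, hm, hn, map_add]
    abel
  zero_mem' := ⟨0, fun g => by simp⟩
  smul_mem' := by
    rintro r a ⟨m, hm⟩
    refine ⟨r • m, fun g => ?_⟩
    simp only [Submodule.coe_smul, Pi.smul_apply, hm, map_smul, smul_sub]

/-- The continuous cohomology group `H¹(U, M)`. -/
abbrev H1 (π : Representation k G M) (U : Subgroup G) : Type _ := Z1 π U ⧸ B1 π U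

/-- Restriction of cocycles from `U` to `W ≤ U`. -/
def Z1res (π : Representation k G M) {W U : Subgroup G} (h : W ≤ U) : Z1 π U →ₗ[k] Z1 π W where
  toFun c := ⟨fun g => c.1 (Subgroup.inclusion h g),
    c.2.1.comp (Continuous.subtype_mk continuous_subtype_val _),
    fun g g' => c.2.2 (Subgroup.inclusion h g) (Subgroup.inclusion h g')⟩
  map_add' _ _ := rfl
  map_smul' _ _ := rfl

/-- The restriction map `H¹(U, M) → H¹(W, M)` for `W ≤ U`. -/
def H1res (π : Representation k G M) {W U : Subgroup G} (h : W ≤ U) : H1 π U →ₗ[k] H1 π W :=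
  Submodule.mapQ _ _ (Z1res π h) (by
    rintro c ⟨m, hm⟩
    exact ⟨m, fun g => hm (Subgroup.inclusion h g)⟩)

theorem H1res_comp (π : Representation k G M) {W U X : Subgroup G} (h : W ≤ U) (h' : U ≤ X)
    (c : H1 π X) : H1res π h (H1res π h' c) = H1res π (h.trans h') c := by
  induction c using Submodule.Quotient.induction_on with
  | H c => rfl

/-- Push-forward of cocycles along a continuous equivariant map of coefficients. -/
def Z1map (π : Representation k G M) (π' : Representation k G N) (f : M →ₗ[k] N)
    (hf : Continuous f) (hπ : ∀ g m, f (π g m) = π' g (f m)) (U : Subgroup G) :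
    Z1 π U →ₗ[k] Z1 π' U where
  toFun c := ⟨fun g => f (c.1 g), hf.comp c.2.1, fun g h => by
    change f (c.1 (g * h)) = f (c.1 g) + π' g (f (c.1 h))
    rw [c.2.2, map_add, hπ]⟩
  map_add' a b := by ext g; simp
  map_smul' r a := by ext g; simp

/-- The map `H¹(U, M) → H¹(U, N)` induced by a continuous equivariant map `M → N`. -/
def H1map (π : Representation k G M) (π' : Representation k G N) (f : M →ₗ[k] N)
    (hf : Continuous f) (hπ : ∀ g m, f (π g m) = π' g (f m)) (U : Subgroup G) :
    H1 π U →ₗ[k] H1 π' U :=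
  Submodule.mapQ _ _ (Z1map π π' f hf hπ U) (by
    rintro c ⟨m, hm⟩
    exact ⟨f m, fun g => by
      change f (c.1 g) = _
      rw [hm, map_sub, hπ]⟩)

theorem H1map_res (π : Representation k G M) (π' : Representation k G N) (f : M →ₗ[k] N)
    (hf : Continuous f) (hπ : ∀ g m, f (π g m) = π' g (f m)) {W U : Subgroup G} (h : W ≤ U)
    (c : H1 π U) :
    H1res π' h (H1map π π' f hf hπ U c) = H1map π π' f hf hπ W (H1res π h c) := by
  induction c using Submodule.Quotient.induction_on with
  | H c => rfl

/-- For a subgroup `I` (the inertia group) of `G`, the unramified classes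
`H¹_nr(U, M) = ker (H¹(U, M) → H¹(U ∩ I, M))`. -/
def H1nr (I : Subgroup G) (π : Representation k G M) (U : Subgroup G) : Submodule k (H1 π U) :=
  LinearMap.ker (H1res π (inf_le_left : U ⊓ I ≤ U))

theorem H1nr_res (I : Subgroup G) (π : Representation k G M) {W U : Subgroup G} (h : W ≤ U) :
    H1nr I π U ≤ (H1nr I π W).comap (H1res π h) := by
  intro c hc
  simp only [H1nr, Submodule.mem_comap, LinearMap.mem_ker] at hc ⊢
  rw [H1res_comp, ← H1res_comp π (inf_le_inf_right I h) inf_le_left, hc, map_zero]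

theorem H1nr_map (I : Subgroup G) (π : Representation k G M) (π' : Representation k G N)
    (f : M →ₗ[k] N) (hf : Continuous f) (hπ : ∀ g m, f (π g m) = π' g (f m)) (U : Subgroup G) :
    (H1nr I π U).map (H1map π π' f hf hπ U) ≤ H1nr I π' U := by
  rintro _ ⟨c, hc, rfl⟩
  simp only [H1nr, SetLike.mem_coe, LinearMap.mem_ker] at hc ⊢
  rw [H1map_res, hc, map_zero]

end Cohomology

/-! ## Galois groups, inertia, Frobenius, cyclotomic tower -/

/-- The absolute Galois group of `ℚ`, with its Krull topology. -/
abbrev GalQ : Type := AlgebraicClosure ℚ ≃ₐ[ℚ] AlgebraicClosure ℚ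

instance : IsAlgClosure ℚ (AlgebraicClosure ℚ) where
  isAlgClosed := inferInstance
  isAlgebraic := by
    refine ⟨fun x => ?_⟩
    obtain ⟨q, hq, h⟩ := (AlgebraicClosure.isAlgebraic ℚ).isAlgebraic x
    refine ⟨q, hq, ?_⟩
    rw [Polynomial.aeval_def] at h ⊢
    rw [← h]
    congr 1

instance : IsGalois ℚ (AlgebraicClosure ℚ) := IsAlgClosure.isGalois ℚ (AlgebraicClosure ℚ)

/-- The absolute Galois group of `ℚ_ℓ`, with its Krull topology. -/
abbrev GalQl (ℓ : ℕ) [Fact ℓ.Prime] : Type := PadicAlgCl ℓ ≃ₐ[ℚ_[ℓ]] PadicAlgCl ℓ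

section Local

variable {ℓ : ℕ} [Fact ℓ.Prime]

/-- The homomorphism `Gal(ℚ̄_ℓ/ℚ_ℓ) → Gal(ℚ̄/ℚ)` attached to an embedding `ι : ℚ̄ → ℚ̄_ℓ`; it is
characterised by `decomp_spec`. -/
def decomp (ι : AlgebraicClosure ℚ →+* PadicAlgCl ℓ) : GalQl ℓ →* GalQ :=
  letI : Algebra (AlgebraicClosure ℚ) (PadicAlgCl ℓ) := ι.toAlgebra
  haveI : IsScalarTower ℚ (AlgebraicClosure ℚ) (PadicAlgCl ℓ) :=
    IsScalarTower.of_algebraMap_eq' (Subsingleton.elim _ _)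
  (AlgEquiv.restrictNormalHom (F := ℚ) (K₁ := PadicAlgCl ℓ) (AlgebraicClosure ℚ)).comp
    (AlgEquiv.restrictScalarsHom ℚ)

theorem decomp_spec (ι : AlgebraicClosure ℚ →+* PadicAlgCl ℓ) (g : GalQl ℓ)
    (x : AlgebraicClosure ℚ) : ι (decomp ι g x) = g (ι x) := by
  let : Algebra (AlgebraicClosure ℚ) (PadicAlgCl ℓ) := ι.toAlgebra
  have : IsScalarTower ℚ (AlgebraicClosure ℚ) (PadicAlgCl ℓ) :=
    IsScalarTower.of_algebraMap_eq' (Subsingleton.elim _ _)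
  exact AlgEquiv.restrictNormal_commutes (AlgEquiv.restrictScalars ℚ g) (AlgebraicClosure ℚ) x

theorem norm_gal (g : GalQl ℓ) (x : PadicAlgCl ℓ) : ‖g x‖ = ‖x‖ :=
  spectralNorm_eq_of_equiv (K := ℚ_[ℓ]) g x |>.symm

variable (ℓ) in
/-- The inertia group `I_ℓ`: automorphisms acting trivially on the residue field of `ℚ̄_ℓ`. -/
def inertia : Subgroup (GalQl ℓ) where
  carrier := {g | ∀ x : PadicAlgCl ℓ, ‖x‖ ≤ 1 → ‖g x - x‖ < 1}
  one_mem' := fun x _ => by simp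
  mul_mem' := by
    intro a b ha hb x hx
    have h1 := ha (b x) (by rwa [norm_gal])
    have h2 := hb x hx
    have : (a * b) x - x = (a (b x) - b x) + (b x - x) := by
      rw [AlgEquiv.mul_apply]; ring
    rw [this]
    exact (IsUltrametricDist.norm_add_le_max _ _).trans_lt (max_lt h1 h2)
  inv_mem' := by
    intro a ha x hx
    have h1 := ha x hx
    have : a⁻¹ x - x = -(a⁻¹ (a x - x)) := by
      rw [map_sub, ← AlgEquiv.mul_apply, inv_mul_cancel, AlgEquiv.one_apply]; ring
    rw [this, norm_neg, norm_gal]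
    exact h1

/-- `σ` is an (arithmetic) Frobenius: it induces `x ↦ x ^ ℓ` on the residue field of `ℚ̄_ℓ`. -/
def IsFrobenius (σ : GalQl ℓ) : Prop :=
  ∀ x : PadicAlgCl ℓ, ‖x‖ ≤ 1 → ‖σ x - x ^ ℓ‖ < 1

/-- `τ ∈ I_ℓ` topologically generates the maximal pro-`p` quotient of `I_ℓ`, that is, its image
generates every finite quotient of `I_ℓ` of `p`-power order.  (For `ℓ ≠ p` the wild inertia group
is pro-`ℓ`, so this is also the maximal pro-`p` quotient of tame inertia.) -/
def IsProPGenerator (p : ℕ) (τ : GalQl ℓ) : Prop :=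
  ∃ h : τ ∈ inertia ℓ, ∀ N : Subgroup (inertia ℓ), N.Normal → IsOpen (N : Set (inertia ℓ)) →
    (∃ m : ℕ, N.index = p ^ m) → Subgroup.zpowers (⟨τ, h⟩ : inertia ℓ) ⊔ N = ⊤

end Local

section Tower

variable (p : ℕ) [Fact p.Prime]

/-- The `p`-adic cyclotomic character `χ` of `Gal(ℚ̄/ℚ)`. -/
def cycChar : GalQ →* ℤ_[p]ˣ :=
  (cyclotomicCharacter (AlgebraicClosure ℚ) p).comp
    (MulSemiringAction.toRingAut GalQ (AlgebraicClosure ℚ))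

/-- The subgroup of all `g` with `χ(g)^(p-1) ≡ 1 mod p^(n+1)`. -/
def layerGroup (n : ℕ) : Subgroup GalQ :=
  ((Units.map (PadicInt.toZModPow (p := p) (n + 1)).toMonoidHom).comp
    ((powMonoidHom (p - 1)).comp (cycChar p))).ker

/-- The `n`-th layer `ℚ_n` of the cyclotomic `ℤ_p`-extension of `ℚ` (for odd `p`): the subfield of
`ℚ(μ_{p^(n+1)})` fixed by the elements of order dividing `p - 1` in its Galois group
`(ℤ/p^(n+1))ˣ`. -/
def layer (n : ℕ) : IntermediateField ℚ (AlgebraicClosure ℚ) :=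
  IntermediateField.fixedField (layerGroup p n)

theorem layerGroup_anti {n m : ℕ} (h : n ≤ m) : layerGroup p m ≤ layerGroup p n := by
  intro g hg
  simp only [layerGroup, MonoidHom.mem_ker, Units.ext_iff] at hg ⊢
  have h2 := congrArg (ZMod.castHom (pow_dvd_pow p (Nat.add_le_add_right h 1))
    (ZMod (p ^ (n + 1)))) hg
  have h3 := congrArg (fun f => f ((powMonoidHom (p - 1)).comp (cycChar p) g : ℤ_[p]))
    (PadicInt.zmod_cast_comp_toZModPow (p := p) (n + 1) (m + 1) (Nat.add_le_add_right h 1))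
  simp only [RingHom.comp_apply] at h3
  calc _ = _ := h3.symm
    _ = _ := by
      refine Eq.trans h2 ?_
      rw [Units.val_one, map_one, Units.val_one]

theorem layer_mono {n m : ℕ} (h : n ≤ m) : layer p n ≤ layer p m :=
  fun _ hx g => hx ⟨g.1, layerGroup_anti p h g.2⟩

/-- The places of `ℚ_n` above `ℓ`. -/
abbrev Places (ℓ n : ℕ) : Type :=
  Ideal.primesOver (Ideal.span {(ℓ : ℤ)}) (𝓞 (layer p n))

/-- For `n ≤ m`, the place of `ℚ_n` below a place of `ℚ_m`. -/
def Places.below {ℓ n m : ℕ} (h : n ≤ m) (w : Places p ℓ m) : Places p ℓ n :=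
  ⟨w.1.comap (NumberField.RingOfIntegers.mapRingHom
      (IntermediateField.inclusion (layer_mono p h)).toRingHom),
    haveI := w.2.1
    Ideal.comap_isPrime _ _,
    ⟨by
      refine w.2.2.over.trans ?_
      rw [Ideal.under_def, Ideal.under_def, Ideal.comap_comap]
      congr 1⟩⟩

variable {p} {ℓ : ℕ} [Fact ℓ.Prime] (ι : AlgebraicClosure ℚ →+* PadicAlgCl ℓ)

variable (p) in
/-- The absolute Galois group, inside `Gal(ℚ̄_ℓ/ℚ_ℓ)`, of the completion of `ℚ_n` at a place above
`ℓ`.  As `ℚ_n/ℚ` is Galois, every `ℚ_ℓ`-embedding into `ℚ̄_ℓ` of the completion at any of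
these places has the same image `ℚ_ℓ · ι(ℚ_n)`, so that the group does not depend on the place. -/
def localLayer (n : ℕ) : Subgroup (GalQl ℓ) := (layer p n).fixingSubgroup.comap (decomp ι)

theorem localLayer_anti {n m : ℕ} (h : n ≤ m) : localLayer p ι m ≤ localLayer p ι n :=
  Subgroup.comap_mono (IntermediateField.fixingSubgroup_antitone (layer_mono p h))

end Tower

/-! ## Local conditions and the invariant `δ_ℓ` -/

section Delta

variable {p : ℕ} [Fact p.Prime] {ℓ : ℕ} [Fact ℓ.Prime]

instance : ContinuousSMul ℤ_[p] ℚ_[p] where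
  continuous_smul := by
    have : (fun q : ℤ_[p] × ℚ_[p] => q.1 • q.2) = fun q => (q.1 : ℚ_[p]) * q.2 := by
      ext q; rw [Algebra.smul_def]; rfl
    rw [this]
    exact (continuous_subtype_val.comp continuous_fst).mul continuous_snd

/-- The `p`-adic vector space `V = ℚ_p²`. -/
abbrev V (p : ℕ) [Fact p.Prime] : Type := Fin 2 → ℚ_[p]

/-- The action on `V` of a group represented by matrices in `GL₂(ℤ_p)` with respect to the standard
basis `(e₁, e₂)`. -/
def repV {G : Type*} [Group G] (R : G →* GL (Fin 2) ℤ_[p]) : Representation ℤ_[p] G (V p) where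
  toFun g := (((R g : Matrix (Fin 2) (Fin 2) ℤ_[p]).map
    (algebraMap ℤ_[p] ℚ_[p])).mulVecLin).restrictScalars ℤ_[p]
  map_one' := by
    apply LinearMap.ext
    intro v
    ext i
    fin_cases i <;> simp
  map_mul' a b := by
    apply LinearMap.ext
    intro v
    simp [Matrix.map_mul]

variable (ι : AlgebraicClosure ℚ →+* PadicAlgCl ℓ) (π : Representation ℤ_[p] GalQ (V p))
  (L : Submodule ℤ_[p] (V p)) (hL : ∀ g, L ≤ L.comap (π g))

/-- `V` as a representation of `Gal(ℚ̄_ℓ/ℚ_ℓ)`. -/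
abbrev locV : Representation ℤ_[p] (GalQl ℓ) (V p) := π.comp (decomp ι)

/-- `V / L` as a representation of `Gal(ℚ̄_ℓ/ℚ_ℓ)`, for a Galois stable lattice `L`. -/
abbrev locA : Representation ℤ_[p] (GalQl ℓ) (V p ⧸ L) := (π.quotient L hL).comp (decomp ι)

/-- `H¹(ℚ_ℓ, V) → H¹(ℚ_ℓ, V / L)`. -/
def mapVA : H1 (locV ι π) ⊤ →ₗ[ℤ_[p]] H1 (locA ι π L hL) ⊤ :=
  H1map (locV ι π) (locA ι π L hL) L.mkQ L.isOpenQuotientMap_mkQ.continuous (fun _ _ => rfl) ⊤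

/-- `H¹_f(ℚ_ℓ, V / L)` (`ℓ ≠ p`): the image of `H¹_nr(ℚ_ℓ, V)`. -/
def H1f : Submodule ℤ_[p] (H1 (locA ι π L hL) ⊤) :=
  (H1nr (inertia ℓ) (locV ι π) ⊤).map (mapVA ι π L hL)

/-- `J_ℓ^BK(A/ℚ) = H¹(ℚ_ℓ, A) / H¹_f(ℚ_ℓ, A)`. -/
abbrev JBK : Type := H1 (locA ι π L hL) ⊤ ⧸ H1f ι π L hL

/-- `H¹(ℚ_{n,v}, A) / H¹_nr(ℚ_{n,v}, A)` for a place `v ∣ ℓ` of `ℚ_n`, where `ℓ ≠ p`. -/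
def LocGr (n : ℕ) : Type :=
  H1 (locA ι π L hL) (localLayer p ι n) ⧸ H1nr (inertia ℓ) (locA ι π L hL) (localLayer p ι n)

instance (n : ℕ) : AddCommGroup (LocGr ι π L hL n) :=
  inferInstanceAs (AddCommGroup (H1 (locA ι π L hL) (localLayer p ι n) ⧸
    H1nr (inertia ℓ) (locA ι π L hL) (localLayer p ι n)))

instance (n : ℕ) : Module ℤ_[p] (LocGr ι π L hL n) :=
  inferInstanceAs (Module ℤ_[p] (H1 (locA ι π L hL) (localLayer p ι n) ⧸
    H1nr (inertia ℓ) (locA ι π L hL) (localLayer p ι n)))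

/-- The restriction map of the local quotients at places `w ∣ v` of `ℚ_m` and `ℚ_n`, `n ≤ m`. -/
def LocGr.res {n m : ℕ} (h : n ≤ m) : LocGr ι π L hL n →ₗ[ℤ_[p]] LocGr ι π L hL m :=
  Submodule.mapQ (H1nr (inertia ℓ) (locA ι π L hL) (localLayer p ι n))
    (H1nr (inertia ℓ) (locA ι π L hL) (localLayer p ι m))
    (H1res (locA ι π L hL) (localLayer_anti ι h)) (H1nr_res _ _ _)

/-- The restriction map `H¹(ℚ_ℓ, A) / H¹_f(ℚ_ℓ, A) → H¹(ℚ_{0,v}, A) / H¹_nr(ℚ_{0,v}, A)`, where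
`ℚ_0 = ℚ`. -/
def JBKtoLocGr : JBK ι π L hL →ₗ[ℤ_[p]] LocGr ι π L hL 0 :=
  Submodule.mapQ (H1f ι π L hL) (H1nr (inertia ℓ) (locA ι π L hL) (localLayer p ι 0))
    (H1res (locA ι π L hL) le_top)
    ((show H1f ι π L hL ≤ H1nr (inertia ℓ) (locA ι π L hL) ⊤ from
      H1nr_map _ _ _ _ _ _ _).trans (H1nr_res _ _ _))

/-- `J_ℓ^Gr(A/ℚ_n) = ⨁_{v ∣ ℓ} H¹(ℚ_{n,v}, A) / H¹_nr(ℚ_{n,v}, A)`; the sum is finite. -/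
abbrev JGr (n : ℕ) : Type := Places p ℓ n → LocGr ι π L hL n

/-- The restriction maps `J_ℓ^Gr(A/ℚ_n) → J_ℓ^Gr(A/ℚ_m)` for `n ≤ m`. -/
def JGrRes (n m : ℕ) (h : n ≤ m) : JGr ι π L hL n →ₗ[ℤ_[p]] JGr ι π L hL m :=
  LinearMap.pi fun w => (LocGr.res ι π L hL h).comp (LinearMap.proj (Places.below p h w))

/-- `J_ℓ^Gr(A/ℚ_∞)`, the direct limit of the `J_ℓ^Gr(A/ℚ_n)`. -/
abbrev JGrInf : Type := Module.DirectLimit (R := ℤ_[p]) (JGr ι π L hL) (JGrRes ι π L hL)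

/-- `J_ℓ^BK(A/ℚ) → J_ℓ^Gr(A/ℚ)`, where `ℚ = ℚ_0`. -/
def JBKtoJGr : JBK ι π L hL →ₗ[ℤ_[p]] JGr ι π L hL 0 :=
  LinearMap.pi fun _ => JBKtoLocGr ι π L hL

/-- The map `h_{ℓ,A} : J_ℓ^BK(A/ℚ) → J_ℓ^Gr(A/ℚ_∞)`.  Its image lies in the `Γ`-invariants; its
kernel does not depend on whether these or the whole module are taken as codomain. -/
def hMap : JBK ι π L hL →ₗ[ℤ_[p]] JGrInf ι π L hL :=
  (Module.DirectLimit.of ℤ_[p] ℕ (JGr ι π L hL) (JGrRes ι π L hL) 0).comp (JBKtoJGr ι π L hL)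

/-- `δ_ℓ(A) = dim_{𝔽_p} (ker h_{ℓ,A})[p]`, as a cardinal. -/
def delta : Cardinal :=
  letI : Module (ZMod p) (AddSubgroup.torsionBy (LinearMap.ker (hMap ι π L hL)) (p : ℤ)) :=
    AddSubgroup.torsionBy.zmodModule
  Module.rank (ZMod p) (AddSubgroup.torsionBy (LinearMap.ker (hMap ι π L hL)) (p : ℤ))

/-- `H⁰(ℚ_ℓ, V / L)`. -/
abbrev H0 : Submodule ℤ_[p] (V p ⧸ L) := (locA ι π L hL).invariants

end Delta

/-! ## The representation, its twist and the two lattices -/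

section Global

variable {p : ℕ} [Fact p.Prime]

/-- The Teichmüller lift of a character with values in `𝔽_pˣ`. -/
def teichLift (β : GalQ →* (ZMod p)ˣ) : GalQ →* ℤ_[p]ˣ :=
  (Units.map ((WittVector.equiv p).toMonoidHom.comp
    (WittVector.teichmuller p : ZMod p →* WittVector p (ZMod p)))).comp β

/-- The twist `ρ ⊗ ψ`, where `ψ` is the inverse of the Teichmüller lift of `β`. -/
def twist (ρ : GalQ →* GL (Fin 2) ℤ_[p]) (β : GalQ →* (ZMod p)ˣ) : GalQ →* GL (Fin 2) ℤ_[p] where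
  toFun g := (teichLift β g)⁻¹ • ρ g
  map_one' := by simp
  map_mul' a b := by
    apply Units.ext
    simp only [map_mul, mul_inv, Units.val_mul, Units.val_smul, smul_mul_smul_comm]

/-- Reduction modulo `p`, `GL₂(ℤ_p) → GL₂(𝔽_p)`. -/
def redGL (p : ℕ) [Fact p.Prime] : GL (Fin 2) ℤ_[p] →* GL (Fin 2) (ZMod p) :=
  Matrix.GeneralLinearGroup.map PadicInt.toZMod

/-- The lattice `T = ℤ_p e₁ ⊕ ℤ_p e₂` in `V`. -/
def latT (p : ℕ) [Fact p.Prime] : Submodule ℤ_[p] (V p) :=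
  Submodule.span ℤ_[p] {![1, 0], ![0, 1]}

/-- The lattice `T' = ℤ_p p⁻¹ e₁ ⊕ ℤ_p e₂` in `V`. -/
def latT' (p : ℕ) [Fact p.Prime] : Submodule ℤ_[p] (V p) :=
  Submodule.span ℤ_[p] {![(p : ℚ_[p])⁻¹, 0], ![0, 1]}

theorem latT_stable {G : Type*} [Group G] (R : G →* GL (Fin 2) ℤ_[p]) (g : G) :
    latT p ≤ (latT p).comap (repV R g) := by
  intro v hv
  obtain ⟨a, b, rfl⟩ := Submodule.mem_span_pair.1 hv
  refine Submodule.mem_span_pair.2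
    ⟨(R g).1 0 0 * a + (R g).1 0 1 * b, (R g).1 1 0 * a + (R g).1 1 1 * b, ?_⟩
  ext i
  fin_cases i <;> simp [repV, Matrix.mulVec, dotProduct, Fin.sum_univ_two, Algebra.smul_def]

theorem latT'_stable {G : Type*} [Group G] {R : G →* GL (Fin 2) ℤ_[p]}
    (hR : ∀ g, (p : ℤ_[p]) ∣ (R g).1 1 0) (g : G) :
    latT' p ≤ (latT' p).comap (repV R g) := by
  intro v hv
  obtain ⟨a, b, rfl⟩ := Submodule.mem_span_pair.1 hv
  obtain ⟨c, hc⟩ := hR g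
  have hp : (p : ℚ_[p]) ≠ 0 := by exact_mod_cast (Fact.out : p.Prime).ne_zero
  refine Submodule.mem_span_pair.2
    ⟨(R g).1 0 0 * a + p * (R g).1 0 1 * b, c * a + (R g).1 1 1 * b, ?_⟩
  have hc' : (((R g).1 1 0 : ℤ_[p]) : ℚ_[p]) = p * c := by rw [hc]; simp
  ext i
  fin_cases i
  · simp [repV, Matrix.mulVec, dotProduct, Fin.sum_univ_two, Algebra.smul_def]
    field_simp
  · simp [repV, Matrix.mulVec, dotProduct, Fin.sum_univ_two, Algebra.smul_def, hc']
    field_simp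

/-- If the reduction of `ρ` modulo `p` is upper triangular, then so is that of every twist. -/
theorem twist_lower {ρ : GalQ →* GL (Fin 2) ℤ_[p]} {ρbar : GalQ →* GL (Fin 2) (ZMod p)}
    (β : GalQ →* (ZMod p)ˣ) (hlift : ∀ g, redGL p (ρ g) = ρbar g)
    (hbar : ∀ g, (ρbar g).1 1 0 = 0) (g : GalQ) : (p : ℤ_[p]) ∣ (twist ρ β g).1 1 0 := by
  have h : PadicInt.toZMod ((ρ g).1 1 0) = 0 := by
    rw [← hbar g, ← hlift g]; rfl
  have h2 : (ρ g).1 1 0 ∈ Ideal.span {(p : ℤ_[p])} := by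
    rw [← PadicInt.maximalIdeal_eq_span_p, ← PadicInt.ker_toZMod]; exact h
  have h3 : (twist ρ β g).1 1 0 = (((teichLift β g)⁻¹ : ℤ_[p]ˣ) : ℤ_[p]) * (ρ g).1 1 0 := rfl
  rw [h3]
  exact (Ideal.mem_span_singleton.1 h2).mul_left _

end Global

/-! ## Trivial primes and the Type III condition -/

section TypeIII

variable {p : ℕ} [Fact p.Prime] {ℓ : ℕ} [Fact ℓ.Prime]

/-- `ℓ` is a trivial prime for `ρbar`: `ℓ ≡ 1 mod p`, `ℓ ≢ 1 mod p²`, and `ρbar` is trivial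
on `Gal(ℚ̄_ℓ/ℚ_ℓ)`. -/
def IsTrivialPrime (ι : AlgebraicClosure ℚ →+* PadicAlgCl ℓ)
    (ρbar : GalQ →* GL (Fin 2) (ZMod p)) : Prop :=
  ℓ ≡ 1 [MOD p] ∧ ¬ ℓ ≡ 1 [MOD p ^ 2] ∧ ∀ g : GalQl ℓ, ρbar (decomp ι g) = 1

/-- The condition `D_ℓ^ram` on (the strict equivalence class of) a homomorphism
`ϱ : Gal(ℚ̄_ℓ/ℚ_ℓ) → GL₂(ℤ_p)`: after conjugation by some matrix in the kernel of
`GL₂(ℤ_p) → GL₂(𝔽_p)` one has `σ ↦ (ℓ x; 0 1)` and `τ ↦ (1 y; 0 1)` with `p² ∣ x` and `p ∥ y`. -/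
def DRam (σ τ : GalQl ℓ) (ϱ : GalQl ℓ →* GL (Fin 2) ℤ_[p]) : Prop :=
  ∃ C ∈ (redGL p).ker, ∃ x y : ℤ_[p],
    (p : ℤ_[p]) ^ 2 ∣ x ∧ (p : ℤ_[p]) ∣ y ∧ ¬ (p : ℤ_[p]) ^ 2 ∣ y ∧
    (C * ϱ σ * C⁻¹ : GL (Fin 2) ℤ_[p]).1 = !![(ℓ : ℤ_[p]), x; 0, 1] ∧
    (C * ϱ τ * C⁻¹ : GL (Fin 2) ℤ_[p]).1 = !![1, y; 0, 1]

/-- The matrix `(0 1; 1 1)`. -/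
def matB (p : ℕ) [Fact p.Prime] : GL (Fin 2) ℤ_[p] :=
  ⟨!![0, 1; 1, 1], !![-1, 1; 1, 0], by simp [Matrix.one_fin_two], by simp [Matrix.one_fin_two]⟩

/-- The Type III condition: `ϱ` is the conjugate by `(0 1; 1 1)` of a representation
satisfying `D_ℓ^ram`. -/
def IsTypeIII (σ τ : GalQl ℓ) (ϱ : GalQl ℓ →* GL (Fin 2) ℤ_[p]) : Prop :=
  ∃ ϱ' : GalQl ℓ →* GL (Fin 2) ℤ_[p], DRam σ τ ϱ' ∧ ∀ g, ϱ g = matB p * ϱ' g * (matB p)⁻¹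

end TypeIII

end TypeThree

end

/-! Since `ℓ ≠ p`, the prime `ℓ` is unramified in the cyclotomic tower: every local layer contains
all of inertia. A class dies in some layer exactly when it is unramified, so the kernel of `h_ℓ` is
`H¹_nr(A) / H¹_f(A)` (`hMap_mk_eq_zero_iff`), and only unramified cohomology over `ℚ_ℓ` has to be
computed.

Inertia and a Frobenius `σ` topologically generate the local group (`IsFrobenius.eq_top`). An
unramified class is therefore given by its value at `σ`, an element of the inertia invariants,
modulo the image of `σ - 1` on these invariants.

Type III provides a basis `f₁, f₂` of `T` with `f₁ ≡ e₂` and `f₂ ≡ e₁ + e₂` mod `p`, in which `ρ(σ)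
= (ℓ x; 0 1)` and `ρ(τ) = (1 y; 0 1)` with `p ∥ y`. As `ρ` is locally trivial mod `p`, its image is
pro-`p`, so all of inertia is unipotent along with `τ` (`IsProPGenerator.eq_unipotent`).

For `A'`: the lattice `T'` has basis `f₁, p⁻¹(f₂ - f₁)`, in which the off-diagonal entry of `τ`
becomes the unit `y / p`. If the twist is trivial on inertia, the invariants of `A'` are contained
in the image of the line `ℚ_p f₁`, on which `σ` acts by `ω(σ)ℓ ≠ 1`; that line is divisible, so `σ -
1` is onto. If the twist is ramified, there are no invariants. Either way `H¹_nr(A') = 0`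
(`H1nr_eq_bot_of_unit`).

For `A` with trivial local twist: the invariants under inertia are `(ℚ_p/ℤ_p) f₁ ⊕ (p⁻¹ℤ_p/ℤ_p) f₂`.
Here `σ - 1` is onto the first summand and kills the second, leaving `H¹_nr(A)` of order `p`, while
`H¹_nr(V) = 0`; hence `δ = 1`. A generator is written down directly from the determinant
(`characterCocycle`), which works because `p ∥ ℓ - 1`. The same divisibility bounds `H⁰`. -/

noncomputable section

namespace TypeThree

/-! ## The residue field of `ℚ̄_ℓ` and topological generation of the local Galois group -/

/-- A ring automorphism of a field algebraic over `𝔽_ℓ` agrees on every finite set with a power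
of the Frobenius. -/
theorem exists_forall_eq_pow_of_ringEquiv {k : Type*} [Field k] (ℓ : ℕ) [Fact ℓ.Prime] [CharP k ℓ]
    (halg : ∀ x : k, ∃ m : ℕ, 0 < m ∧ x ^ ℓ ^ m = x) (φ : k ≃+* k) (S : Set k) (hS : S.Finite) :
    ∃ n : ℕ, ∀ x ∈ S, φ x = x ^ ℓ ^ n := by
  let : Algebra (ZMod ℓ) k := ZMod.algebra k ℓ
  have hint : ∀ x : k, IsIntegral (ZMod ℓ) x := by
    intro x
    obtain ⟨m, hm, hx⟩ := halg x
    have h1 : 1 < ℓ ^ m := Nat.one_lt_pow hm.ne' (Fact.out : ℓ.Prime).one_lt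
    refine ⟨Polynomial.X ^ ℓ ^ m - Polynomial.X, ?_, by simp [hx]⟩
    exact Polynomial.monic_X_pow_sub (by rw [Polynomial.degree_X]; exact_mod_cast h1)
  let F := IntermediateField.adjoin (ZMod ℓ) S
  have : Finite S := hS
  have : FiniteDimensional (ZMod ℓ) F :=
    IntermediateField.finiteDimensional_adjoin fun x _ => hint x
  have : Finite F := Module.finite_of_finite (ZMod ℓ)
  let ψ : k ≃ₐ[ZMod ℓ] k := AlgEquiv.ofRingEquiv (f := φ) fun r => by
    have : (φ : k →+* k).comp (algebraMap (ZMod ℓ) k) = algebraMap (ZMod ℓ) k :=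
      Subsingleton.elim _ _
    exact congrArg (fun f => f r) this
  -- The finite set generates a finite field, whose automorphism group consists of powers of
  -- Frobenius.
  obtain ⟨n, hn⟩ := (FiniteField.bijective_frobeniusAlgEquivOfAlgebraic_pow (ZMod ℓ) F).2
    (ψ.restrictNormal F)
  refine ⟨n, fun x hx => ?_⟩
  have hxF : x ∈ F := IntermediateField.subset_adjoin _ _ hx
  have h1 := AlgEquiv.restrictNormal_commutes ψ F ⟨x, hxF⟩
  rw [← hn] at h1
  simp only [AlgEquiv.coe_pow, FiniteField.coe_frobeniusAlgEquivOfAlgebraic_iterate] at h1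
  rw [ZMod.card] at h1
  exact h1.symm

section Residue

variable {ℓ : ℕ} [Fact ℓ.Prime]

variable (ℓ) in
/-- The ring of integers of `ℚ̄_ℓ`. -/
abbrev integers : ValuationSubring (PadicAlgCl ℓ) :=
  (Valued.v : Valuation (PadicAlgCl ℓ) NNReal).valuationSubring

theorem mem_integers {x : PadicAlgCl ℓ} : x ∈ integers ℓ ↔ ‖x‖ ≤ 1 := by
  rw [Valuation.mem_valuationSubring_iff, PadicAlgCl.valuation_def]
  exact Iff.rfl

theorem residue_eq_zero_iff {x : integers ℓ} :
    IsLocalRing.residue (integers ℓ) x = 0 ↔ ‖(x : PadicAlgCl ℓ)‖ < 1 := by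
  rw [IsLocalRing.residue_eq_zero_iff, IsLocalRing.mem_maximalIdeal, mem_nonunits_iff, not_iff_comm,
    not_lt]
  have hx := mem_integers.1 x.2
  constructor
  · intro h
    have h0 : (x : PadicAlgCl ℓ) ≠ 0 := by
      intro h0; rw [h0, norm_zero] at h; linarith
    have hinv : (x : PadicAlgCl ℓ)⁻¹ ∈ integers ℓ := mem_integers.2 (by
      rw [norm_inv]; exact inv_le_one_of_one_le₀ h)
    exact IsUnit.of_mul_eq_one ⟨_, hinv⟩ (Subtype.ext (mul_inv_cancel₀ h0))
  · intro h
    obtain ⟨y, hy⟩ := h.exists_right_inv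
    have h1 : ‖(x : PadicAlgCl ℓ)‖ * ‖(y : PadicAlgCl ℓ)‖ = 1 := by
      rw [← norm_mul]
      have := congrArg (fun z : integers ℓ => ‖(z : PadicAlgCl ℓ)‖) hy
      simpa using this
    have hy1 := mem_integers.1 y.2
    nlinarith [norm_nonneg (x : PadicAlgCl ℓ)]

theorem residue_eq_iff {x y : integers ℓ} :
    IsLocalRing.residue (integers ℓ) x = IsLocalRing.residue (integers ℓ) y ↔
      ‖(x : PadicAlgCl ℓ) - y‖ < 1 := by
  rw [← sub_eq_zero, ← map_sub, residue_eq_zero_iff]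
  rfl

/-- The action of the local Galois group on the ring of integers. -/
def integersEquiv (g : GalQl ℓ) : integers ℓ ≃+* integers ℓ where
  toFun x := ⟨g x, mem_integers.2 (by rw [norm_gal]; exact mem_integers.1 x.2)⟩
  invFun x := ⟨g⁻¹ x, mem_integers.2 (by rw [norm_gal]; exact mem_integers.1 x.2)⟩
  left_inv x := Subtype.ext (g.symm_apply_apply _)
  right_inv x := Subtype.ext (g.apply_symm_apply _)
  map_mul' x y := Subtype.ext (map_mul g _ _)
  map_add' x y := Subtype.ext (map_add g _ _)

theorem norm_natCast_self_lt : ‖(ℓ : PadicAlgCl ℓ)‖ < 1 := by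
  rw [← map_natCast (algebraMap ℚ_[ℓ] (PadicAlgCl ℓ)), norm_algebraMap']
  exact Padic.norm_p_lt_one

theorem norm_natCast_of_coprime {n : ℕ} (h : n.Coprime ℓ) : ‖(n : PadicAlgCl ℓ)‖ = 1 := by
  rw [← map_natCast (algebraMap ℚ_[ℓ] (PadicAlgCl ℓ)), norm_algebraMap']
  exact Padic.norm_natCast_eq_one_iff.2 h.symm

instance : CharP (IsLocalRing.ResidueField (integers ℓ)) ℓ := by
  refine (CharP.charP_iff_prime_eq_zero (Fact.out : ℓ.Prime)).2 ?_
  rw [← map_natCast (IsLocalRing.residue (integers ℓ)), residue_eq_zero_iff]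
  exact_mod_cast norm_natCast_self_lt

/-- The orbit of `x` lies among the finitely many roots of its minimal polynomial. Applied to a
Frobenius, this shows that the residue field is algebraic over `𝔽_ℓ`. -/
theorem exists_pow_apply_eq (σ : GalQl ℓ) (x : PadicAlgCl ℓ) : ∃ m : ℕ, 0 < m ∧ (σ ^ m) x = x := by
  have hx : IsIntegral ℚ_[ℓ] x := (PadicAlgCl.isAlgebraic ℓ).isAlgebraic x |>.isIntegral
  let f : ℕ → (minpoly ℚ_[ℓ] x).rootSet (PadicAlgCl ℓ) := fun m => ⟨(σ ^ m) x, by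
    rw [Polynomial.mem_rootSet]
    refine ⟨minpoly.ne_zero hx, ?_⟩
    rw [← AlgEquiv.coe_toAlgHom, Polynomial.aeval_algHom_apply, minpoly.aeval, map_zero]⟩
  obtain ⟨a, b, hab, h⟩ := Finite.exists_ne_map_eq_of_infinite f
  wlog hlt : a < b generalizing a b
  · exact this b a hab.symm h.symm (lt_of_le_of_ne (not_lt.1 hlt) hab.symm)
  refine ⟨b - a, Nat.sub_pos_of_lt hlt, (σ ^ a).injective ?_⟩
  rw [← AlgEquiv.mul_apply, ← pow_add, Nat.add_sub_cancel' hlt.le]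
  exact (congrArg Subtype.val h).symm

theorem IsFrobenius.pow {σ : GalQl ℓ} (hσ : IsFrobenius σ) (n : ℕ) (x : PadicAlgCl ℓ)
    (hx : ‖x‖ ≤ 1) : ‖(σ ^ n) x - x ^ ℓ ^ n‖ < 1 := by
  induction n with
  | zero => simp
  | succ n ih =>
    have h1 : ‖σ ((σ ^ n) x) - σ (x ^ ℓ ^ n)‖ < 1 := by rwa [← map_sub, norm_gal]
    have h2 := hσ (x ^ ℓ ^ n) (by rw [norm_pow]; exact pow_le_one₀ (norm_nonneg _) hx)
    have : (σ ^ (n + 1)) x - x ^ ℓ ^ (n + 1) =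
        (σ ((σ ^ n) x) - σ (x ^ ℓ ^ n)) + (σ (x ^ ℓ ^ n) - (x ^ ℓ ^ n) ^ ℓ) := by
      rw [pow_succ' σ, AlgEquiv.mul_apply, pow_succ ℓ, pow_mul]; ring
    rw [this]
    exact (IsUltrametricDist.norm_add_le_max _ _).trans_lt (max_lt h1 h2)

/-- Every automorphism agrees, on the residues of finitely many integers, with a power of a
Frobenius. -/
theorem IsFrobenius.exists_pow {σ : GalQl ℓ} (hσ : IsFrobenius σ) (g : GalQl ℓ)
    (S : Finset (integers ℓ)) :
    ∃ n : ℕ, ∀ x ∈ S, ‖g x - (σ ^ n) (x : PadicAlgCl ℓ)‖ < 1 := by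
  have halg : ∀ y : IsLocalRing.ResidueField (integers ℓ), ∃ m : ℕ, 0 < m ∧ y ^ ℓ ^ m = y := by
    intro y
    obtain ⟨x, rfl⟩ := IsLocalRing.residue_surjective y
    obtain ⟨m, hm, h⟩ := exists_pow_apply_eq σ (x : PadicAlgCl ℓ)
    refine ⟨m, hm, ?_⟩
    rw [← map_pow, eq_comm, residue_eq_iff]
    have := hσ.pow m x (mem_integers.1 x.2)
    rwa [h] at this
  obtain ⟨n, hn⟩ := exists_forall_eq_pow_of_ringEquiv ℓ halg
    (IsLocalRing.ResidueField.mapEquiv (integersEquiv g))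
    (IsLocalRing.residue (integers ℓ) '' S) (S.finite_toSet.image _)
  refine ⟨n, fun x hx => ?_⟩
  have h1 := hn _ ⟨x, hx, rfl⟩
  have h2 : IsLocalRing.residue (integers ℓ) (integersEquiv g x) =
    IsLocalRing.residue (integers ℓ) (x ^ ℓ ^ n) := by
    rw [map_pow, ← h1]; rfl
  rw [residue_eq_iff] at h2
  have h3 := hσ.pow n x (mem_integers.1 x.2)
  have : g x - (σ ^ n) (x : PadicAlgCl ℓ) =
    (g x - (x : PadicAlgCl ℓ) ^ ℓ ^ n) - ((σ ^ n) (x : PadicAlgCl ℓ) - (x : PadicAlgCl ℓ) ^ ℓ ^ n) := by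
    ring
  rw [this, sub_eq_add_neg]
  refine (IsUltrametricDist.norm_add_le_max _ _).trans_lt (max_lt h2 ?_)
  rwa [norm_neg]

theorem isOpen_setOf_apply_eq (x y : PadicAlgCl ℓ) : IsOpen {g : GalQl ℓ | g x = y} := by
  rw [isOpen_iff_mem_nhds]
  intro g hg
  have h := (stabilizer_isOpen_of_isIntegral (K := ℚ_[ℓ]) x).leftCoset g
  refine Filter.mem_of_superset (h.mem_nhds ⟨1, one_mem _, mul_one g⟩) ?_
  rintro _ ⟨s, hs, rfl⟩
  change g (s x) = y
  rw [show s x = x from hs]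
  exact hg

theorem isClosed_setOf_apply_mem (x : PadicAlgCl ℓ) (S : Set (PadicAlgCl ℓ)) :
    IsClosed {g : GalQl ℓ | g x ∈ S} := by
  have : {g : GalQl ℓ | g x ∈ S}ᶜ = ⋃ y ∈ Sᶜ, {g : GalQl ℓ | g x = y} := by
    ext g; simp
  rw [← isOpen_compl_iff, this]
  exact isOpen_biUnion fun y _ => isOpen_setOf_apply_eq x y

/-- The local Galois group is topologically generated by inertia and a Frobenius. -/
theorem IsFrobenius.eq_top {σ : GalQl ℓ} (hσ : IsFrobenius σ) (H : Subgroup (GalQl ℓ))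
    (hH : IsClosed (H : Set (GalQl ℓ))) (hI : inertia ℓ ≤ H) (hσH : σ ∈ H) : H = ⊤ := by
  classical
  have : IsGalois ℚ_[ℓ] (PadicAlgCl ℓ) := IsAlgClosure.isGalois ℚ_[ℓ] (PadicAlgCl ℓ)
  refine eq_top_iff.2 fun g _ => ?_
  -- The elements of `H` with the same effect as `g` on the residues of `S`. These closed sets are
  -- nonempty because powers of `σ` suffice for finite `S`. By compactness a single `s ∈ H` induces
  -- the same residue automorphism as `g`, and then `s⁻¹ g` is inertial.
  let K : Finset (integers ℓ) → Set (GalQl ℓ) := fun S =>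
    H ∩ ⋂ x ∈ S, {s | s (x : PadicAlgCl ℓ) ∈ {y | ‖g x - y‖ < 1}}
  have hclosed : ∀ S, IsClosed (K S) := fun S =>
    hH.inter (isClosed_biInter fun x _ => isClosed_setOf_apply_mem _ _)
  obtain ⟨s, hs⟩ := IsCompact.nonempty_iInter_of_directed_nonempty_isCompact_isClosed K
    (by
      intro S T
      refine ⟨S ∪ T, fun s hs => ⟨hs.1, ?_⟩, fun s hs => ⟨hs.1, ?_⟩⟩ <;>
      · refine Set.mem_iInter₂.2 fun x hx => Set.mem_iInter₂.1 hs.2 x ?_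
        simp [hx])
    (fun S => by
      obtain ⟨n, hn⟩ := hσ.exists_pow g S
      exact ⟨σ ^ n, pow_mem hσH n, Set.mem_iInter₂.2 hn⟩)
    (fun S => (hclosed S).isCompact) hclosed
  have hs' := Set.mem_iInter.1 hs
  have h1 : s⁻¹ * g ∈ inertia ℓ := by
    intro x hx
    have h2 := Set.mem_iInter₂.1 (hs' {⟨x, mem_integers.2 hx⟩}).2 _ (Finset.mem_singleton_self _)
    have h3 : (s⁻¹ * g) x - x = s⁻¹ (g x - s x) := by
      rw [map_sub, AlgEquiv.mul_apply, ← AlgEquiv.mul_apply s⁻¹ s, inv_mul_cancel,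
        AlgEquiv.one_apply]
    rw [h3, norm_gal]
    exact h2
  have h4 := H.mul_mem (hs' ∅).1 (hI h1)
  rwa [mul_inv_cancel_left] at h4

instance : (inertia ℓ).Normal where
  conj_mem i hi g x hx := by
    have h1 := hi (g⁻¹ x) (by rwa [norm_gal])
    rw [← norm_gal g, map_sub] at h1
    have h2 : g (g⁻¹ x) = x := by
      rw [← AlgEquiv.mul_apply, mul_inv_cancel, AlgEquiv.one_apply]
    rw [h2] at h1
    exact h1

/-- Inertia fixes all roots of unity of order prime to `ℓ`. -/
theorem inertia_apply_rootOfUnity {g : GalQl ℓ} (hg : g ∈ inertia ℓ) {n : ℕ} (hn : n.Coprime ℓ)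
    {ζ : PadicAlgCl ℓ} (hζ : ζ ^ n = 1) : g ζ = ζ := by
  have hn0 : n ≠ 0 := by
    rintro rfl
    exact (Fact.out : ℓ.Prime).one_lt.ne' ((Nat.coprime_zero_left ℓ).1 hn)
  have hnorm : ‖ζ‖ = 1 := by
    have : ‖ζ‖ ^ n = 1 := by rw [← norm_pow, hζ, norm_one]
    exact (pow_eq_one_iff_of_nonneg (norm_nonneg _) hn0).1 this
  have hζ0 : ζ ≠ 0 := by rintro rfl; simp at hnorm
  -- The `n`-th root of unity `u` is congruent to `1`, so `1 + u + ⋯ + u^(n-1)` is congruent to the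
  -- unit `n` and is nonzero. Its product with `u - 1` vanishes, which forces `u = 1`.
  set u := g ζ / ζ with hu
  have hun : u ^ n = 1 := by rw [hu, div_pow, ← map_pow, hζ, map_one, div_one]
  have hu1 : ‖u - 1‖ < 1 := by
    have : u - 1 = (g ζ - ζ) / ζ := by rw [hu, sub_div, div_self hζ0]
    rw [this, norm_div, hnorm, div_one]
    exact hg ζ hnorm.le
  have hun1 : ‖u‖ = 1 := by rw [hu, norm_div, norm_gal, hnorm, div_one]
  have hpow : ∀ j : ℕ, ‖u ^ j - 1‖ < 1 := by
    intro j
    induction j with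
    | zero => simp
    | succ j ih =>
      have : u ^ (j + 1) - 1 = u ^ j * (u - 1) + (u ^ j - 1) := by ring
      rw [this]
      refine (IsUltrametricDist.norm_add_le_max _ _).trans_lt (max_lt ?_ ih)
      rwa [norm_mul, norm_pow, hun1, one_pow, one_mul]
  have hsum : ‖∑ j ∈ Finset.range n, u ^ j - n‖ < 1 := by
    have : ∑ j ∈ Finset.range n, u ^ j - (n : PadicAlgCl ℓ) =
        ∑ j ∈ Finset.range n, (u ^ j - 1) := by simp
    rw [this]
    obtain ⟨j, -, hj⟩ := IsUltrametricDist.exists_norm_finsetSum_le_of_nonempty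
      (Finset.nonempty_range_iff.2 hn0) (fun j => u ^ j - 1)
    exact hj.trans_lt (hpow j)
  have hne : ∑ j ∈ Finset.range n, u ^ j ≠ 0 := by
    intro h
    rw [h, zero_sub, norm_neg, norm_natCast_of_coprime hn] at hsum
    exact lt_irrefl _ hsum
  have h0 : (∑ j ∈ Finset.range n, u ^ j) * (u - 1) = 0 := by
    rw [geom_sum_mul, hun, sub_self]
  have : u = 1 := sub_eq_zero.1 ((mul_eq_zero.1 h0).resolve_left hne)
  rwa [hu, div_eq_one_iff_eq hζ0] at this

end Residue

/-! ### Continuity of restriction to the local group, and inertia in the cyclotomic tower -/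

section Decomp

variable {p : ℕ} [Fact p.Prime] {ℓ : ℕ} [Fact ℓ.Prime] (ι : AlgebraicClosure ℚ →+* PadicAlgCl ℓ)

theorem continuous_decomp : Continuous (decomp ι) := by
  refine continuous_of_continuousAt_one _ ?_
  rw [ContinuousAt, map_one]
  intro s hs
  obtain ⟨E, hE, hEs⟩ := (krullTopology_mem_nhds_one_iff ℚ (AlgebraicClosure ℚ) s).1 hs
  obtain ⟨S, hS⟩ := IntermediateField.essFiniteType_iff.1 (inferInstance : Algebra.EssFiniteType ℚ E)
  refine Filter.mem_map.2 <| Filter.mem_of_superset ((Filter.biInter_finset_mem S).2 fun x _ =>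
    (isOpen_setOf_apply_eq (ι x) (ι x)).mem_nhds (show (1 : GalQl ℓ) (ι x) = ι x from rfl)) ?_
  intro g hg
  refine hEs ?_
  -- Fixing the finitely many generators of `E` is an open condition on `g`; the fixed field of the
  -- group generated by `g` then contains all of `E`.
  have hle : E ≤ IntermediateField.fixedField (Subgroup.zpowers (decomp ι g)) := by
    rw [← hS, IntermediateField.adjoin_le_iff]
    intro x hx
    have h1 : decomp ι g x = x :=
      ι.injective (by rw [decomp_spec]; exact Set.mem_iInter₂.1 hg x hx)
    rintro ⟨h, hh⟩
    exact (Subgroup.zpowers_le (H := MulAction.stabilizer GalQ x)).2 h1 hh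
  exact fun x => hle x.2 ⟨_, Subgroup.mem_zpowers _⟩

/-- Inertia fixes the roots of unity of `p`-power order, so the cyclotomic character is trivial on
it modulo every `p^(n+1)`. -/
theorem inertia_le_localLayer (hpl : p ≠ ℓ) (n : ℕ) : inertia ℓ ≤ localLayer p ι n := by
  intro g hg
  have h1 : decomp ι g ∈ layerGroup p n := by
    have h2 : PadicInt.toZModPow (p := p) (n + 1) (cycChar p (decomp ι g)).1 = 1 := by
      rw [cycChar]
      refine (cyclotomicCharacter.toZModPow p _).trans ?_
      refine (modularCyclotomicCharacter.unique _ _ _ (c := 1) fun t ht => ?_).symm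
      have : Fact (1 < p ^ (n + 1)) := ⟨Nat.one_lt_pow n.succ_ne_zero (Fact.out : p.Prime).one_lt⟩
      rw [ZMod.val_one, pow_one]
      refine ι.injective ((decomp_spec ι g _).trans (inertia_apply_rootOfUnity hg
        (Nat.Coprime.pow_left (n + 1) ((Nat.coprime_primes Fact.out Fact.out).2 hpl)) ?_))
      rw [← map_pow, ← Units.val_pow_eq_pow_val, (mem_rootsOfUnity _ _).1 ht, Units.val_one,
        map_one]
    rw [layerGroup, MonoidHom.mem_ker]
    apply Units.ext
    simp [h2]
  exact fun x => x.2 ⟨_, h1⟩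

end Decomp

/-! ## Unramified classes -/

section Unramified

variable {k G M : Type*} [CommRing k] [Group G] [TopologicalSpace G]
  [AddCommGroup M] [Module k M] [TopologicalSpace M] [IsTopologicalAddGroup M]
  [ContinuousConstSMul k M] {π : Representation k G M} {I : Subgroup G}

/-- The principal crossed homomorphism attached to `m`, as a cocycle on the whole group. -/
def coboundary (hπ : ∀ m, Continuous fun g => π g m) (m : M) : Z1 π (⊤ : Subgroup G) :=
  ⟨fun g => π g m - m, ((hπ m).comp continuous_subtype_val).sub continuous_const, fun g h => by
    change π (g.1 * h.1) m - m = π g.1 m - m + π g.1 (π h.1 m - m)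
    rw [map_mul, Module.End.mul_apply, map_sub]
    abel⟩

theorem coboundary_mem (hπ : ∀ m, Continuous fun g => π g m) (m : M) :
    coboundary hπ m ∈ B1 π ⊤ :=
  ⟨m, fun _ => rfl⟩

/-- An unramified class is represented by a cocycle which vanishes on inertia. -/
theorem exists_eq_zero_on_of_mem_H1nr (hπ : ∀ m, Continuous fun g => π g m) {x : H1 π ⊤}
    (hx : x ∈ H1nr I π ⊤) :
    ∃ c : Z1 π ⊤, Submodule.Quotient.mk c = x ∧ ∀ i : (⊤ : Subgroup G), i.1 ∈ I → c.1 i = 0 := by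
  obtain ⟨c, rfl⟩ := Submodule.Quotient.mk_surjective _ x
  obtain ⟨m, hm⟩ := (Submodule.Quotient.mk_eq_zero _).1 (LinearMap.mem_ker.1 hx)
  refine ⟨c - coboundary hπ m, ?_, fun i hi => ?_⟩
  · rw [Submodule.Quotient.eq, sub_sub_cancel_left]
    exact neg_mem (coboundary_mem hπ m)
  · exact sub_eq_zero.2 (hm ⟨i.1, i.2, hi⟩)

theorem mk_mem_H1nr {c : Z1 π (⊤ : Subgroup G)}
    (hc : ∀ i : (⊤ : Subgroup G), i.1 ∈ I → c.1 i = 0) :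
    (Submodule.Quotient.mk c : H1 π ⊤) ∈ H1nr I π ⊤ :=
  LinearMap.mem_ker.2 <| (Submodule.Quotient.mk_eq_zero _).2
    ⟨0, fun g => (hc _ g.2.2).trans (by simp)⟩

/-- A cocycle which vanishes on inertia takes values in the inertia invariants. -/
theorem apply_eq_of_eq_zero_on [I.Normal] {c : Z1 π (⊤ : Subgroup G)}
    (hc : ∀ i : (⊤ : Subgroup G), i.1 ∈ I → c.1 i = 0) (g : (⊤ : Subgroup G)) {i : G}
    (hi : i ∈ I) : π i (c.1 g) = c.1 g := by
  -- Compute `c(ig) = c(g · g⁻¹ig)` in two ways, using that `g⁻¹ig` is again in the normal subgroup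
  -- `I`.
  have h1 := c.2.2 ⟨i, trivial⟩ g
  have h2 := c.2.2 g (g⁻¹ * ⟨i, trivial⟩ * g)
  have h3 : (g⁻¹ * ⟨i, trivial⟩ * g : (⊤ : Subgroup G)).1 ∈ I := by
    have := (inferInstance : I.Normal).conj_mem i hi (g.1)⁻¹
    rwa [inv_inv] at this
  rw [hc _ h3, map_zero, add_zero, mul_assoc, mul_inv_cancel_left, h1, hc _ hi, zero_add] at h2
  exact h2

/-- A cocycle is determined by its values on topological generators. -/
theorem eq_zero_of_generators [T1Space M] {σ : G}
    (hgen : ∀ H : Subgroup G, IsClosed (H : Set G) → I ≤ H → σ ∈ H → H = ⊤)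
    {c : Z1 π (⊤ : Subgroup G)} (hc : ∀ i : (⊤ : Subgroup G), i.1 ∈ I → c.1 i = 0)
    (hσ : c.1 ⟨σ, trivial⟩ = 0) : c = 0 := by
  let H : Subgroup G :=
    { carrier := {g | c.1 ⟨g, trivial⟩ = 0}
      one_mem' := hc _ I.one_mem
      mul_mem' := fun {a b} ha hb => by
        have := c.2.2 ⟨a, trivial⟩ ⟨b, trivial⟩
        rw [ha, hb, map_zero, add_zero] at this
        exact this
      inv_mem' := fun {a} ha => by
        have h1 := c.2.2 ⟨a⁻¹, trivial⟩ ⟨a, trivial⟩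
        rw [ha, map_zero, add_zero] at h1
        refine h1.symm.trans (hc _ ?_)
        simp [I.one_mem] }
  have hH : H = ⊤ := by
    refine hgen H ?_ (fun i hi => hc ⟨i, trivial⟩ hi) hσ
    exact isClosed_singleton.preimage
      (c.2.1.comp (Continuous.subtype_mk continuous_id fun _ => trivial))
  ext g
  have : g.1 ∈ H := by rw [hH]; trivial
  exact this

/-- If a cocycle vanishing on inertia agrees at `σ` with a coboundary of an inertia invariant
element, then its class is zero. -/
theorem mk_eq_zero_of_generators [T1Space M] {σ : G}
    (hgen : ∀ H : Subgroup G, IsClosed (H : Set G) → I ≤ H → σ ∈ H → H = ⊤)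
    (hπ : ∀ m, Continuous fun g => π g m)
    {c : Z1 π (⊤ : Subgroup G)} (hc : ∀ i : (⊤ : Subgroup G), i.1 ∈ I → c.1 i = 0)
    {m : M} (hm : ∀ i ∈ I, π i m = m) (hσ : c.1 ⟨σ, trivial⟩ = π σ m - m) :
    (Submodule.Quotient.mk c : H1 π ⊤) = 0 := by
  have : c - coboundary hπ m = 0 := eq_zero_of_generators hgen
    (fun i hi => by
      change c.1 i - (π i.1 m - m) = 0
      rw [hc i hi, hm i.1 hi, sub_self, sub_zero])
    (sub_eq_zero.2 hσ)
  rw [sub_eq_zero.1 this]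
  exact (Submodule.Quotient.mk_eq_zero _).2 (coboundary_mem hπ m)

/-- Criterion behind both vanishing results: unramified cohomology is controlled by the cokernel of
`σ - 1` on the inertia invariants. -/
theorem H1nr_eq_bot [T1Space M] [I.Normal] {σ : G}
    (hgen : ∀ H : Subgroup G, IsClosed (H : Set G) → I ≤ H → σ ∈ H → H = ⊤)
    (hπ : ∀ m, Continuous fun g => π g m)
    (h : ∀ m, (∀ i ∈ I, π i m = m) → ∃ n, (∀ i ∈ I, π i n = n) ∧ π σ n - n = m) :
    H1nr I π ⊤ = ⊥ := by
  refine (Submodule.eq_bot_iff _).2 fun x hx => ?_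
  obtain ⟨c, rfl, hc⟩ := exists_eq_zero_on_of_mem_H1nr hπ hx
  obtain ⟨n, hn, hσ⟩ := h (c.1 ⟨σ, trivial⟩) fun i hi => apply_eq_of_eq_zero_on hc _ hi
  exact mk_eq_zero_of_generators hgen hπ hc hn hσ.symm

end Unramified

/-! ## The kernel of `h_ℓ` -/

section Places

variable {p : ℕ} [Fact p.Prime] {ℓ : ℕ}

theorem Places.below_refl {n : ℕ} (w : Places p ℓ n) : Places.below p le_rfl w = w :=
  Subtype.ext rfl

theorem Places.below_val {n m : ℕ} (h : n ≤ m) (w : Places p ℓ m) :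
    (Places.below p h w).1 = w.1.comap (NumberField.RingOfIntegers.mapRingHom
      (IntermediateField.inclusion (layer_mono p h)).toRingHom) :=
  rfl

theorem Places.below_below {n m r : ℕ} (h : n ≤ m) (h' : m ≤ r) (w : Places p ℓ r) :
    Places.below p h (Places.below p h' w) = Places.below p (h.trans h') w := by
  refine Subtype.ext ?_
  rw [Places.below_val, Places.below_val, Places.below_val, Ideal.comap_comap]
  refine congrArg (fun f => Ideal.comap f w.1) ?_
  refine RingHom.ext fun x => NumberField.RingOfIntegers.ext ?_
  rw [RingHom.comp_apply, NumberField.RingOfIntegers.mapRingHom_apply,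
    NumberField.RingOfIntegers.mapRingHom_apply, NumberField.RingOfIntegers.mapRingHom_apply]
  exact IntermediateField.inclusion_inclusion _ _ _

end Places

section Kernel

variable {p : ℕ} [Fact p.Prime] {ℓ : ℕ} [Fact ℓ.Prime]
variable (ι : AlgebraicClosure ℚ →+* PadicAlgCl ℓ) (π : Representation ℤ_[p] GalQ (V p))
  (L : Submodule ℤ_[p] (V p)) (hL : ∀ g, L ≤ L.comap (π g))

theorem LocGr.res_res {n m r : ℕ} (h : n ≤ m) (h' : m ≤ r) (x : LocGr ι π L hL n) :
    LocGr.res ι π L hL h' (LocGr.res ι π L hL h x) = LocGr.res ι π L hL (h.trans h') x := by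
  obtain ⟨x, rfl⟩ := Submodule.Quotient.mk_surjective _ x
  exact congrArg Submodule.Quotient.mk (H1res_comp _ _ _ x)

theorem LocGr.res_refl {n : ℕ} (x : LocGr ι π L hL n) :
    LocGr.res ι π L hL le_rfl x = x := by
  obtain ⟨x, rfl⟩ := Submodule.Quotient.mk_surjective _ x
  induction x using Submodule.Quotient.induction_on with
  | H c => rfl

theorem JGrRes_apply {n m : ℕ} (h : n ≤ m) (x : JGr ι π L hL n) (w : Places p ℓ m) :
    JGrRes ι π L hL n m h x w = LocGr.res ι π L hL h (x (Places.below p h w)) :=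
  rfl

instance : DirectedSystem (JGr ι π L hL) fun i j h => JGrRes ι π L hL i j h where
  map_self i x := by
    funext w
    rw [JGrRes_apply, LocGr.res_refl, Places.below_refl]
  map_map i j k hij hjk x := by
    funext w
    rw [JGrRes_apply, JGrRes_apply, JGrRes_apply, LocGr.res_res, Places.below_below]

instance (n : ℕ) : Nonempty (Places p ℓ n) := by
  have : (Ideal.span {(ℓ : ℤ)}).IsPrime :=
    (Ideal.span_singleton_prime (by exact_mod_cast (Fact.out : ℓ.Prime).ne_zero)).2
      (Nat.prime_iff_prime_int.1 Fact.out)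
  infer_instance

/-- The kernel of `h_ℓ` consists of the unramified classes. -/
theorem hMap_mk_eq_zero_iff (hpl : p ≠ ℓ) (x : H1 (locA ι π L hL) ⊤) :
    hMap ι π L hL (Submodule.Quotient.mk x) = 0 ↔ x ∈ H1nr (inertia ℓ) (locA ι π L hL) ⊤ := by
  constructor
  · intro h
    -- Vanishing in the limit happens at a finite layer `j`; any one place there suffices, since the
    -- layer's local group contains the full inertia group.
    obtain ⟨j, hj, h⟩ := Module.DirectLimit.of.zero_exact h
    have w : Places p ℓ j := Classical.arbitrary _
    have h1 := congrFun h w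
    have h2 : H1res (locA ι π L hL) (localLayer_anti ι hj)
        (H1res (locA ι π L hL) le_top x) ∈
        H1nr (inertia ℓ) (locA ι π L hL) (localLayer p ι j) :=
      (Submodule.Quotient.mk_eq_zero _).1 h1
    rw [H1nr, LinearMap.mem_ker, H1res_comp, H1res_comp] at h2
    have hle : ⊤ ⊓ inertia ℓ ≤ localLayer p ι j ⊓ inertia ℓ := fun g hg =>
      ⟨inertia_le_localLayer ι hpl j hg.2, hg.2⟩
    rw [H1nr, LinearMap.mem_ker, ← H1res_comp _ hle (inf_le_left.trans le_top), h2, map_zero]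
  · intro h
    have h1 : JBKtoLocGr ι π L hL (Submodule.Quotient.mk x) = 0 :=
      (Submodule.Quotient.mk_eq_zero _).2 (H1nr_res _ _ _ h)
    have h2 : JBKtoJGr ι π L hL (Submodule.Quotient.mk x) = 0 := funext fun _ => h1
    rw [hMap, LinearMap.comp_apply, h2, map_zero]

end Kernel

/-! ### Estimates in `ℚ_p` -/

section Norm

variable {p : ℕ} [Fact p.Prime]

theorem norm_mul_le_one_of_dvd {z : ℤ_[p]} (hz : (p : ℤ_[p]) ∣ z) {b : ℚ_[p]}
    (hb : ‖(p : ℚ_[p]) * b‖ ≤ 1) : ‖(z : ℚ_[p]) * b‖ ≤ 1 := by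
  obtain ⟨w, rfl⟩ := hz
  have : ((p * w : ℤ_[p]) : ℚ_[p]) * b = w * (p * b) := by push_cast; ring
  rw [this, norm_mul]
  exact mul_le_one₀ w.2 (norm_nonneg _) hb

theorem norm_eq_of_dvd_of_not_dvd {y : ℤ_[p]} (hy : (p : ℤ_[p]) ∣ y)
    (hy2 : ¬ (p : ℤ_[p]) ^ 2 ∣ y) : ‖(y : ℚ_[p])‖ = ‖(p : ℚ_[p])‖ := by
  obtain ⟨w, rfl⟩ := hy
  have hw : ‖w‖ = 1 := by
    refine le_antisymm w.2 (not_lt.1 fun h => hy2 ?_)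
    rw [pow_two]
    exact mul_dvd_mul_left _ (PadicInt.norm_lt_one_iff_dvd w |>.1 h)
  have hw' : ‖(w : ℚ_[p])‖ = 1 := hw
  push_cast
  rw [norm_mul, hw', mul_one]

/-- Distinct roots of unity of order dividing `p - 1` stay distinct mod `p`. Indeed `ω^(p^k) = ω`
for all `k`, so `p ∣ ω - 1` would give `p^(k+1) ∣ ω - 1` for all `k`. -/
theorem norm_sub_one_of_pow_eq_one {ω : ℤ_[p]} (hω : ω ^ (p - 1) = 1) (h1 : ω ≠ 1) :
    ‖(ω : ℚ_[p]) - 1‖ = 1 := by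
  have h : ‖ω - 1‖ = 1 := by
    refine le_antisymm (ω - 1).2 (not_lt.1 fun h => h1 ?_)
    have hd : (p : ℤ_[p]) ∣ ω - 1 := (PadicInt.norm_lt_one_iff_dvd _).1 h
    have hp1 : p - 1 + 1 = p := Nat.sub_add_cancel (Fact.out : p.Prime).one_le
    have hpk : ∀ k : ℕ, ω ^ p ^ k = ω := by
      intro k
      induction k with
      | zero => simp
      | succ k ih =>
        rw [pow_succ, pow_mul, ih]
        calc ω ^ p = ω ^ (p - 1 + 1) := by rw [hp1]
          _ = ω := by rw [pow_succ, hω, one_mul]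
    have hp_lt : ‖(p : ℤ_[p])‖ < 1 := (PadicInt.norm_lt_one_iff_dvd _).2 dvd_rfl
    have hk : ∀ k : ℕ, (p : ℤ_[p]) ^ (k + 1) ∣ ω - 1 := by
      intro k
      have := dvd_sub_pow_of_dvd_sub hd k
      rwa [hpk, one_pow] at this
    refine sub_eq_zero.1 (norm_eq_zero.1 ?_)
    by_contra hne
    obtain ⟨k, hk'⟩ := exists_pow_lt_of_lt_one
      (lt_of_le_of_ne (norm_nonneg (ω - 1)) (Ne.symm hne)) hp_lt
    have h2 : ‖ω - 1‖ ≤ ‖(p : ℤ_[p])‖ ^ (k + 1) := by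
      obtain ⟨w, hw⟩ := hk k
      rw [hw, norm_mul, norm_pow]
      exact mul_le_of_le_one_right (by positivity) w.2
    have h3 : ‖(p : ℤ_[p])‖ ^ (k + 1) ≤ ‖(p : ℤ_[p])‖ ^ k :=
      pow_le_pow_of_le_one (norm_nonneg _) hp_lt.le k.le_succ
    linarith
  exact_mod_cast h

end Norm

/-! ## Unramified cohomology of the two lattices in adapted coordinates -/

section Coordinates

variable {p : ℕ} [Fact p.Prime] {L : Submodule ℤ_[p] (V p)} {e : ℚ_[p] × ℚ_[p] ≃+ V p}

theorem exists_mk_eq (e : ℚ_[p] × ℚ_[p] ≃+ V p) (m : V p ⧸ L) :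
    ∃ a b : ℚ_[p], L.mkQ (e (a, b)) = m := by
  obtain ⟨v, rfl⟩ := L.mkQ_surjective m
  exact ⟨(e.symm v).1, (e.symm v).2, by simp⟩

theorem mk_eq_mk_iff {a b c d : ℚ_[p]} :
    L.mkQ (e (a, b)) = L.mkQ (e (c, d)) ↔ e (a - c, b - d) ∈ L := by
  rw [← sub_eq_zero, ← map_sub, ← map_sub, Prod.mk_sub_mk, Submodule.mkQ_apply,
    Submodule.Quotient.mk_eq_zero]

theorem mk_sub_mk (a b c d : ℚ_[p]) :
    L.mkQ (e (a, b)) - L.mkQ (e (c, d)) = L.mkQ (e (a - c, b - d)) := by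
  rw [← map_sub, ← map_sub, Prod.mk_sub_mk]

variable {G : Type*} [Group G] {I : Subgroup G} {σ τ : G}
  {π : Representation ℤ_[p] G (V p)} {πQ : Representation ℤ_[p] G (V p ⧸ L)}

/-- An element of `V / L` fixed by `τ` has second coordinate in `p⁻¹ ℤ_p`. -/
theorem norm_le_one_of_fixed (hπ : ∀ g v, πQ g (L.mkQ v) = L.mkQ (π g v))
    (hL : ∀ a b, e (a, b) ∈ L ↔ ‖a‖ ≤ 1 ∧ ‖b‖ ≤ 1)
    {y : ℤ_[p]} (hy : (p : ℤ_[p]) ∣ y) (hy2 : ¬ (p : ℤ_[p]) ^ 2 ∣ y)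
    (hτ : ∀ a b, π τ (e (a, b)) = e (a + y * b, b)) {a b : ℚ_[p]}
    (h : πQ τ (L.mkQ (e (a, b))) = L.mkQ (e (a, b))) : ‖(p : ℚ_[p]) * b‖ ≤ 1 := by
  rw [hπ, hτ, mk_eq_mk_iff, hL, add_sub_cancel_left] at h
  rw [norm_mul, ← norm_eq_of_dvd_of_not_dvd hy hy2, ← norm_mul]
  exact h.1

/-- Invariance under `τ` bounds `b` by `p ∥ y`; then `xb` is integral and invariance under `σ`
bounds `a` by `p ∥ q - 1`. So the invariants lie in `p⁻¹L / L`, represented by pairs of digits. -/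
theorem finite_invariants (hπ : ∀ g v, πQ g (L.mkQ v) = L.mkQ (π g v))
    (hL : ∀ a b, e (a, b) ∈ L ↔ ‖a‖ ≤ 1 ∧ ‖b‖ ≤ 1)
    {q x y : ℤ_[p]} (hq : (p : ℤ_[p]) ∣ q - 1) (hq2 : ¬ (p : ℤ_[p]) ^ 2 ∣ q - 1)
    (hx : (p : ℤ_[p]) ∣ x) (hσ : ∀ a b, π σ (e (a, b)) = e (q * a + x * b, b))
    (hy : (p : ℤ_[p]) ∣ y) (hy2 : ¬ (p : ℤ_[p]) ^ 2 ∣ y)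
    (hτ : ∀ a b, π τ (e (a, b)) = e (a + y * b, b)) :
    Finite πQ.invariants := by
  let f : Fin p × Fin p → V p ⧸ L := fun s =>
    L.mkQ (e ((s.1 : ℕ) / (p : ℚ_[p]), (s.2 : ℕ) / (p : ℚ_[p])))
  have hp0 : (p : ℚ_[p]) ≠ 0 := by exact_mod_cast (Fact.out : p.Prime).ne_zero
  have key : ∀ a : ℚ_[p], ‖(p : ℚ_[p]) * a‖ ≤ 1 →
      ∃ n : Fin p, ‖a - (n : ℕ) / (p : ℚ_[p])‖ ≤ 1 := by
    intro a ha
    obtain ⟨n, hn, hn'⟩ := PadicInt.exists_mem_range (p := p) ⟨_, ha⟩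
    refine ⟨⟨n, hn⟩, ?_⟩
    rw [PadicInt.maximalIdeal_eq_span_p, Ideal.mem_span_singleton] at hn'
    obtain ⟨w, hw⟩ := hn'
    have h1 : (p : ℚ_[p]) * a - n = p * w := by
      have := congrArg (fun t : ℤ_[p] => (t : ℚ_[p])) hw
      simp only [PadicInt.coe_natCast, PadicInt.coe_mul] at this
      exact this
    have h2 : a - n / (p : ℚ_[p]) = w := by
      field_simp
      linear_combination h1
    rw [h2]
    exact w.2
  refine Set.Finite.subset (Set.finite_range f) fun m hm => ?_
  obtain ⟨a, b, rfl⟩ := exists_mk_eq e m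
  have hb := norm_le_one_of_fixed hπ hL hy hy2 hτ (hm τ)
  have h1 := hm σ
  rw [hπ, hσ, mk_eq_mk_iff, hL] at h1
  have ha : ‖(p : ℚ_[p]) * a‖ ≤ 1 := by
    have h2 := norm_mul_le_one_of_dvd hx hb
    have h3 : ((q - 1 : ℤ_[p]) : ℚ_[p]) * a = (q * a + x * b - a) - x * b := by push_cast; ring
    rw [norm_mul, ← norm_eq_of_dvd_of_not_dvd hq hq2, ← norm_mul, h3, sub_eq_add_neg]
    refine (Padic.nonarchimedean _ _).trans (max_le h1.1 ?_)
    rwa [norm_neg]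
  obtain ⟨i, hi⟩ := key a ha
  obtain ⟨j, hj⟩ := key b hb
  exact ⟨(i, j), (mk_eq_mk_iff.2 ((hL _ _).2 ⟨hi, hj⟩)).symm⟩

variable [TopologicalSpace G]

/-- The unramified cohomology of `V / L` vanishes if `τ` acts, in a basis of the lattice `L`,
by a unipotent matrix whose upper right entry is a unit. -/
theorem H1nr_eq_bot_of_unit [T1Space (V p ⧸ L)] [I.Normal]
    (hgen : ∀ H : Subgroup G, IsClosed (H : Set G) → I ≤ H → σ ∈ H → H = ⊤)
    (hcont : ∀ m, Continuous fun g => πQ g m) (hπ : ∀ g v, πQ g (L.mkQ v) = L.mkQ (π g v))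
    (hL : ∀ a b, e (a, b) ∈ L ↔ ‖a + b‖ ≤ 1 ∧ ‖(p : ℚ_[p]) * b‖ ≤ 1)
    (ω : G → ℤ_[p]) (hω : ∀ g, ω g ^ (p - 1) = 1)
    (hI : ∀ i ∈ I, ∃ z : ℤ_[p], (p : ℤ_[p]) ∣ z ∧
      ∀ a b, π i (e (a, b)) = e (ω i * (a + z * b), ω i * b))
    {q x y : ℤ_[p]} (hq : q ^ (p - 1) ≠ 1)
    (hσ : ∀ a b, π σ (e (a, b)) = e (ω σ * (q * a + x * b), ω σ * b))
    (hτI : τ ∈ I) (hy : (p : ℤ_[p]) ∣ y) (hy2 : ¬ (p : ℤ_[p]) ^ 2 ∣ y)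
    (hτ : ∀ a b, π τ (e (a, b)) = e (ω τ * (a + y * b), ω τ * b)) :
    H1nr I πQ ⊤ = ⊥ := by
  refine H1nr_eq_bot hgen hcont fun m hm => ?_
  obtain ⟨a, b, rfl⟩ := exists_mk_eq e m
  -- With the twist unramified, fixedness under `τ` gives `pb` integral, so the element equals the
  -- class of `(a + b, 0)`, where `σ - 1` can be inverted. With a ramified twist, `ω i - 1` is a
  -- unit and the element is already zero.
  by_cases hωI : ∀ i ∈ I, ω i = 1
  · have h1 := hm τ hτI
    rw [hπ, hτ, hωI τ hτI, mk_eq_mk_iff, hL] at h1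
    have hb : ‖(p : ℚ_[p]) * b‖ ≤ 1 := by
      have := h1.1
      rw [PadicInt.coe_one, one_mul, one_mul, sub_self, add_zero, add_sub_cancel_left] at this
      rwa [norm_mul, ← norm_eq_of_dvd_of_not_dvd hy hy2, ← norm_mul]
    have h2 : L.mkQ (e (a, b)) = L.mkQ (e (a + b, 0)) := by
      rw [mk_eq_mk_iff, hL]
      constructor
      · have : a - (a + b) + (b - 0) = 0 := by ring
        rw [this, norm_zero]; exact zero_le_one
      · rwa [sub_zero]
    -- The `(p-1)`-st power removes `ω σ` and reduces this to `q^(p-1) ≠ 1`.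
    have hne : (ω σ : ℚ_[p]) * q - 1 ≠ 0 := by
      intro h
      have h3 : ω σ * q = 1 := by
        have := sub_eq_zero.1 h
        exact PadicInt.ext (by push_cast; exact this)
      have h4 := congrArg (· ^ (p - 1)) h3
      simp only [mul_pow, hω, one_mul, one_pow] at h4
      exact hq h4
    refine ⟨L.mkQ (e ((a + b) / ((ω σ : ℚ_[p]) * q - 1), 0)), fun i hi => ?_, ?_⟩
    · obtain ⟨z, -, hz⟩ := hI i hi
      rw [hπ, hz, hωI i hi]
      simp
    · rw [h2, hπ, hσ, mk_sub_mk]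
      congr 3
      · field_simp
        ring
      · simp
  · push Not at hωI
    obtain ⟨i, hi, hωi⟩ := hωI
    obtain ⟨z, hz, hiz⟩ := hI i hi
    have h1 := hm i hi
    rw [hπ, hiz, mk_eq_mk_iff, hL] at h1
    have hn := norm_sub_one_of_pow_eq_one (hω i) hωi
    have hb : ‖(p : ℚ_[p]) * b‖ ≤ 1 := by
      have h2 := h1.2
      have : (p : ℚ_[p]) * (ω i * b - b) = (ω i - 1) * (p * b) := by ring
      rwa [this, norm_mul, hn, one_mul] at h2
    have hab : ‖a + b‖ ≤ 1 := by
      have h2 := norm_mul_le_one_of_dvd (hz.mul_left (ω i)) hb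
      have h3 : ((ω i : ℚ_[p]) - 1) * (a + b) =
          (ω i * (a + z * b) - a + (ω i * b - b)) - ((ω i * z : ℤ_[p]) : ℚ_[p]) * b := by
        push_cast; ring
      have h4 : ‖a + b‖ = ‖((ω i : ℚ_[p]) - 1) * (a + b)‖ := by rw [norm_mul, hn, one_mul]
      rw [h4, h3, sub_eq_add_neg]
      refine (Padic.nonarchimedean _ _).trans (max_le h1.1 ?_)
      rwa [norm_neg]
    have h0 : L.mkQ (e (a, b)) = 0 := (Submodule.Quotient.mk_eq_zero _).2 ((hL a b).2 ⟨hab, hb⟩)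
    exact ⟨0, fun _ _ => map_zero _, by rw [map_zero, sub_zero, h0]⟩

/-- The unramified cohomology of `V` vanishes. -/
theorem H1nr_vectorSpace_eq_bot [I.Normal]
    (hgen : ∀ H : Subgroup G, IsClosed (H : Set G) → I ≤ H → σ ∈ H → H = ⊤)
    (hcont : ∀ m, Continuous fun g => π g m)
    (hI : ∀ i ∈ I, ∃ z : ℤ_[p], ∀ a b, π i (e (a, b)) = e (a + z * b, b))
    {q x y : ℤ_[p]} (hq : q ≠ 1) (hσ : ∀ a b, π σ (e (a, b)) = e (q * a + x * b, b))
    (hτI : τ ∈ I) (hy : y ≠ 0) (hτ : ∀ a b, π τ (e (a, b)) = e (a + y * b, b)) :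
    H1nr I π ⊤ = ⊥ := by
  refine H1nr_eq_bot hgen hcont fun m hm => ?_
  obtain ⟨⟨a, b⟩, rfl⟩ := e.surjective m
  have h1 := hm τ hτI
  rw [hτ, e.injective.eq_iff, Prod.mk.injEq, add_eq_left, mul_eq_zero] at h1
  have hb : b = 0 := h1.1.resolve_left fun h => hy (PadicInt.ext h)
  subst hb
  have hne : (q : ℚ_[p]) - 1 ≠ 0 := sub_ne_zero.2 fun h => hq (PadicInt.ext h)
  refine ⟨e (a / ((q : ℚ_[p]) - 1), 0), fun i hi => ?_, ?_⟩
  · obtain ⟨z, hz⟩ := hI i hi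
    rw [hz]; simp
  · rw [hσ, ← map_sub, Prod.mk_sub_mk]
    congr 2
    · field_simp
      ring
    · simp

theorem exists_coe_eq_of_dvd_sub_one {t : ℤ_[p]} (h : (p : ℤ_[p]) ∣ t - 1) :
    ∃ w : ℤ_[p], (t : ℚ_[p]) = 1 + p * w := by
  obtain ⟨w, hw⟩ := h
  exact ⟨w, by rw [eq_add_of_sub_eq' hw]; push_cast; ring⟩

/-- The cocycle `g ↦ p⁻² (d(g) - 1) f₂` with values in `p⁻¹ L / L`, for a character
`d ≡ 1 mod p`. -/
def characterCocycle (hπ : ∀ g v, πQ g (L.mkQ v) = L.mkQ (π g v))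
    (hL : ∀ a b, e (a, b) ∈ L ↔ ‖a‖ ≤ 1 ∧ ‖b‖ ≤ 1) (he : Continuous e)
    (hG : ∀ g b, ‖(p : ℚ_[p]) * b‖ ≤ 1 → π g (e (0, b)) - e (0, b) ∈ L)
    (d : G →* ℤ_[p]) (hd : Continuous d) (hd1 : ∀ g, (p : ℤ_[p]) ∣ d g - 1) :
    Z1 πQ (⊤ : Subgroup G) :=
  ⟨fun g => L.mkQ (e (0, ((d g : ℚ_[p]) - 1) / p ^ 2)), by
    have hp0 : (p : ℚ_[p]) ≠ 0 := by exact_mod_cast (Fact.out : p.Prime).ne_zero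
    constructor
    · refine L.isOpenQuotientMap_mkQ.continuous.comp (he.comp (continuous_const.prodMk ?_))
      exact ((continuous_subtype_val.comp (hd.comp continuous_subtype_val)).sub
        continuous_const).div_const _
    · intro g h
      obtain ⟨w, hw⟩ := exists_coe_eq_of_dvd_sub_one (hd1 h)
      obtain ⟨w', hw'⟩ := exists_coe_eq_of_dvd_sub_one (hd1 g)
      have h1 : πQ g (L.mkQ (e (0, ((d h : ℚ_[p]) - 1) / p ^ 2))) =
          L.mkQ (e (0, ((d h : ℚ_[p]) - 1) / p ^ 2)) := by
        rw [hπ, ← sub_eq_zero, ← map_sub]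
        refine (Submodule.Quotient.mk_eq_zero _).2 (hG _ _ ?_)
        have h3 : (p : ℚ_[p]) * ((1 + p * w - 1) / p ^ 2) = w := by field_simp; ring
        rw [hw, h3]
        exact w.2
      rw [h1, ← map_add, ← map_add, Prod.mk_add_mk, mk_eq_mk_iff, hL]
      refine ⟨by simp, ?_⟩
      -- The failure of `d - 1` to be additive is `(d(g) - 1)(d(h) - 1)`, a multiple of `p²`; it
      -- disappears modulo `L`.
      have h4 : ((d (g * h : (⊤ : Subgroup G)) : ℚ_[p]) - 1) / p ^ 2 -
          (((d g : ℚ_[p]) - 1) / p ^ 2 + ((d h : ℚ_[p]) - 1) / p ^ 2) =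
          (w' * w : ℤ_[p]) := by
        rw [Subgroup.coe_mul, map_mul, PadicInt.coe_mul, PadicInt.coe_mul, hw, hw']
        field_simp
        ring
      rw [h4]
      exact (w' * w).2⟩

/-- Since `σ` fixes the second coordinate, every coboundary has zero second coordinate at `σ` modulo
`L`, whereas that of the cocycle is not integral. -/
theorem characterCocycle_mk_ne_zero (hπ : ∀ g v, πQ g (L.mkQ v) = L.mkQ (π g v))
    (hL : ∀ a b, e (a, b) ∈ L ↔ ‖a‖ ≤ 1 ∧ ‖b‖ ≤ 1) (he : Continuous e)
    (hG : ∀ g b, ‖(p : ℚ_[p]) * b‖ ≤ 1 → π g (e (0, b)) - e (0, b) ∈ L)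
    (d : G →* ℤ_[p]) (hd : Continuous d) (hd1 : ∀ g, (p : ℤ_[p]) ∣ d g - 1)
    (hdσ : ¬ (p : ℤ_[p]) ^ 2 ∣ d σ - 1)
    {q x : ℤ_[p]} (hσ : ∀ a b, π σ (e (a, b)) = e (q * a + x * b, b)) :
    (Submodule.Quotient.mk (characterCocycle hπ hL he hG d hd hd1) : H1 πQ ⊤) ≠ 0 := by
  intro h
  obtain ⟨m, hm⟩ := (Submodule.Quotient.mk_eq_zero _).1 h
  obtain ⟨a, b, rfl⟩ := exists_mk_eq e m
  have h1 : L.mkQ (e (0, ((d σ : ℚ_[p]) - 1) / p ^ 2)) =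
    πQ σ (L.mkQ (e (a, b))) - L.mkQ (e (a, b)) := hm ⟨σ, trivial⟩
  rw [hπ, hσ, mk_sub_mk, mk_eq_mk_iff, hL] at h1
  have h2 := h1.2
  rw [sub_self, sub_zero] at h2
  obtain ⟨t, ht⟩ : ∃ t : ℤ_[p], (t : ℚ_[p]) = ((d σ : ℚ_[p]) - 1) / p ^ 2 := ⟨⟨_, h2⟩, rfl⟩
  refine hdσ ⟨t, PadicInt.ext ?_⟩
  have hp0 : (p : ℚ_[p]) ≠ 0 := by exact_mod_cast (Fact.out : p.Prime).ne_zero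
  push_cast
  rw [ht]
  field_simp

/-- The value at `σ` of an inertia-trivial cocycle is `(a, b)` with `pb` integral. The coordinate
`b` is matched by a multiple of the character cocycle, and `a` by the coboundary of `a / (q - 1)`.
-/
theorem exists_eq_nsmul_characterCocycle [T1Space (V p ⧸ L)] [I.Normal]
    (hgen : ∀ H : Subgroup G, IsClosed (H : Set G) → I ≤ H → σ ∈ H → H = ⊤)
    (hcont : ∀ m, Continuous fun g => πQ g m)
    (hπ : ∀ g v, πQ g (L.mkQ v) = L.mkQ (π g v))
    (hL : ∀ a b, e (a, b) ∈ L ↔ ‖a‖ ≤ 1 ∧ ‖b‖ ≤ 1) (he : Continuous e)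
    (hG : ∀ g b, ‖(p : ℚ_[p]) * b‖ ≤ 1 → π g (e (0, b)) - e (0, b) ∈ L)
    (d : G →* ℤ_[p]) (hd : Continuous d) (hd1 : ∀ g, (p : ℤ_[p]) ∣ d g - 1)
    (hdI : ∀ i ∈ I, d i = 1) (hdσ : ¬ (p : ℤ_[p]) ^ 2 ∣ d σ - 1)
    (hI : ∀ i ∈ I, ∃ z : ℤ_[p], ∀ a b, π i (e (a, b)) = e (a + z * b, b))
    {q x y : ℤ_[p]} (hq : q ≠ 1) (hσ : ∀ a b, π σ (e (a, b)) = e (q * a + x * b, b))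
    (hτI : τ ∈ I) (hy : (p : ℤ_[p]) ∣ y) (hy2 : ¬ (p : ℤ_[p]) ^ 2 ∣ y)
    (hτ : ∀ a b, π τ (e (a, b)) = e (a + y * b, b)) {X : H1 πQ ⊤} (hX : X ∈ H1nr I πQ ⊤) :
    ∃ n : ℕ, X = n • Submodule.Quotient.mk (characterCocycle hπ hL he hG d hd hd1) := by
  obtain ⟨c, rfl, hc⟩ := exists_eq_zero_on_of_mem_H1nr hcont hX
  have hp0 : (p : ℚ_[p]) ≠ 0 := by exact_mod_cast (Fact.out : p.Prime).ne_zero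
  obtain ⟨a, b, hab⟩ := exists_mk_eq e (c.1 ⟨σ, trivial⟩)
  have hb := norm_le_one_of_fixed hπ hL hy hy2 hτ
    (hab ▸ apply_eq_of_eq_zero_on hc ⟨σ, trivial⟩ hτI)
  obtain ⟨w, hw⟩ := hd1 σ
  have hw1 : IsUnit w := by
    rw [PadicInt.isUnit_iff]
    refine le_antisymm w.2 (not_lt.1 fun h => hdσ ?_)
    rw [hw, pow_two]
    exact mul_dvd_mul_left _ ((PadicInt.norm_lt_one_iff_dvd w).1 h)
  obtain ⟨w', hw'⟩ := hw1.exists_right_inv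
  obtain ⟨t, ht⟩ : ∃ t : ℤ_[p], (t : ℚ_[p]) = (p : ℚ_[p]) * b := ⟨⟨_, hb⟩, rfl⟩
  -- With `d σ - 1 = pw` the cocycle has second coordinate `w / p` at `σ`; so `n` must be `w⁻¹ · pb`
  -- modulo `p`.
  obtain ⟨n, -, hn⟩ := PadicInt.exists_mem_range (p := p) (w' * t)
  rw [PadicInt.maximalIdeal_eq_span_p, Ideal.mem_span_singleton] at hn
  obtain ⟨r, hr⟩ := hn
  refine ⟨n, ?_⟩
  have hcoe : (d σ : ℚ_[p]) - 1 = p * w := by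
    have := congrArg (fun t : ℤ_[p] => (t : ℚ_[p])) hw
    simp only [PadicInt.coe_sub, PadicInt.coe_natCast, PadicInt.coe_mul, PadicInt.coe_one] at this
    exact this
  have hbn : b - n * (((d σ : ℚ_[p]) - 1) / p ^ 2) = (w * r : ℤ_[p]) := by
    have h1 := congrArg (fun t : ℤ_[p] => (t : ℚ_[p])) hr
    have h2 := congrArg (fun t : ℤ_[p] => (t : ℚ_[p])) hw'
    simp only [PadicInt.coe_sub, PadicInt.coe_natCast, PadicInt.coe_mul, PadicInt.coe_one, ht] at h1 h2
    rw [hcoe, PadicInt.coe_mul]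
    field_simp
    linear_combination (w : ℚ_[p]) * h1 - p * b * h2
  have hne : (q : ℚ_[p]) - 1 ≠ 0 := sub_ne_zero.2 fun h => hq (PadicInt.ext h)
  rw [← sub_eq_zero]
  refine mk_eq_zero_of_generators (c := c - n • characterCocycle hπ hL he hG d hd hd1)
    (m := L.mkQ (e (a / ((q : ℚ_[p]) - 1), 0))) hgen hcont (fun i hi => ?_) (fun i hi => ?_) ?_
  · change c.1 i - n • L.mkQ (e (0, ((d i : ℚ_[p]) - 1) / p ^ 2)) = 0
    rw [hc i hi, hdI _ hi]
    have : e (0, 0) = 0 := map_zero e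
    simp [this]
  · obtain ⟨z, hz⟩ := hI i hi
    rw [hπ, hz]
    simp
  · change c.1 ⟨σ, trivial⟩ - n • L.mkQ (e (0, ((d σ : ℚ_[p]) - 1) / p ^ 2)) = _
    rw [← hab, ← map_nsmul, ← map_nsmul, Prod.smul_mk, mk_sub_mk, hπ, hσ, mk_sub_mk,
      mk_eq_mk_iff, hL]
    constructor
    · have : a - n • (0 : ℚ_[p]) - ((q : ℚ_[p]) * (a / ((q : ℚ_[p]) - 1)) + x * 0 -
          a / ((q : ℚ_[p]) - 1)) = 0 := by
        rw [smul_zero]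
        field_simp
        ring
      rw [this, norm_zero]
      exact zero_le_one
    · rw [nsmul_eq_mul, hbn, sub_self, sub_zero]
      exact (w * r).2

theorem nsmul_characterCocycle (hπ : ∀ g v, πQ g (L.mkQ v) = L.mkQ (π g v))
    (hL : ∀ a b, e (a, b) ∈ L ↔ ‖a‖ ≤ 1 ∧ ‖b‖ ≤ 1) (he : Continuous e)
    (hG : ∀ g b, ‖(p : ℚ_[p]) * b‖ ≤ 1 → π g (e (0, b)) - e (0, b) ∈ L)
    (d : G →* ℤ_[p]) (hd : Continuous d) (hd1 : ∀ g, (p : ℤ_[p]) ∣ d g - 1) :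
    p • characterCocycle hπ hL he hG d hd hd1 = 0 := by
  ext g
  change p • L.mkQ (e (0, ((d g : ℚ_[p]) - 1) / p ^ 2)) = 0
  obtain ⟨w, hw⟩ := exists_coe_eq_of_dvd_sub_one (hd1 g)
  have hp0 : (p : ℚ_[p]) ≠ 0 := by exact_mod_cast (Fact.out : p.Prime).ne_zero
  rw [← map_nsmul, ← map_nsmul]
  refine (Submodule.Quotient.mk_eq_zero _).2 ?_
  rw [Prod.smul_mk, hL, smul_zero, norm_zero, nsmul_eq_mul, hw]
  refine ⟨zero_le_one, ?_⟩
  have h3 : (p : ℚ_[p]) * ((1 + p * w - 1) / p ^ 2) = w := by field_simp; ring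
  rw [h3]
  exact w.2

end Coordinates

/-! ### From unramified cohomology to `δ_ℓ` -/

section DeltaRank

theorem rank_torsionBy_eq_one {p : ℕ} [Fact p.Prime] {K : Type*} [AddCommGroup K] (v : K)
    (hv0 : v ≠ 0) (hpv : p • v = 0) (hv : ∀ t : K, ∃ n : ℕ, n • v = t) :
    letI : Module (ZMod p) (AddSubgroup.torsionBy K (p : ℤ)) := AddSubgroup.torsionBy.zmodModule
    Module.rank (ZMod p) (AddSubgroup.torsionBy K (p : ℤ)) = 1 := by
  let : Module (ZMod p) (AddSubgroup.torsionBy K (p : ℤ)) := AddSubgroup.torsionBy.zmodModule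
  refine rank_eq_one_iff.2 ⟨⟨v, AddSubgroup.torsionBy.nsmul_iff.2 hpv⟩,
    fun h => hv0 (congrArg Subtype.val h), fun t => ?_⟩
  obtain ⟨n, hn⟩ := hv t.1
  refine ⟨n, ?_⟩
  rw [Nat.cast_smul_eq_nsmul]
  exact Subtype.ext hn

variable {p : ℕ} [Fact p.Prime] {ℓ : ℕ} [Fact ℓ.Prime]
variable {ι : AlgebraicClosure ℚ →+* PadicAlgCl ℓ} {π : Representation ℤ_[p] GalQ (V p)}
  {L : Submodule ℤ_[p] (V p)} {hL : ∀ g, L ≤ L.comap (π g)}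

theorem delta_eq_zero (hpl : p ≠ ℓ) (h : H1nr (inertia ℓ) (locA ι π L hL) ⊤ = ⊥) :
    delta ι π L hL = 0 := by
  have h1 : ∀ x : JBK ι π L hL, hMap ι π L hL x = 0 → x = 0 := by
    intro x hx
    obtain ⟨x, rfl⟩ := Submodule.Quotient.mk_surjective _ x
    have h2 := (hMap_mk_eq_zero_iff ι π L hL hpl x).1 hx
    rw [h, Submodule.mem_bot] at h2
    rw [h2, Submodule.Quotient.mk_zero]
  have : Subsingleton (AddSubgroup.torsionBy (LinearMap.ker (hMap ι π L hL)) (p : ℤ)) :=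
    ⟨fun a b => Subtype.ext (Subtype.ext ((h1 _ a.1.2).trans (h1 _ b.1.2).symm))⟩
  rw [delta]
  let : Module (ZMod p) (AddSubgroup.torsionBy (LinearMap.ker (hMap ι π L hL)) (p : ℤ)) :=
    AddSubgroup.torsionBy.zmodModule
  exact rank_subsingleton' _ _

/-- Because `H¹_nr(V) = 0`, nothing is divided out by `H¹_f`, and the kernel of `h_ℓ` is the
`𝔽_p`-line spanned by `x`. -/
theorem delta_eq_one (hpl : p ≠ ℓ) (hV : H1nr (inertia ℓ) (locV ι π) ⊤ = ⊥)
    {x : H1 (locA ι π L hL) ⊤} (hx : x ∈ H1nr (inertia ℓ) (locA ι π L hL) ⊤) (hx0 : x ≠ 0)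
    (hpx : p • x = 0) (hall : ∀ y ∈ H1nr (inertia ℓ) (locA ι π L hL) ⊤, ∃ n : ℕ, y = n • x) :
    delta ι π L hL = 1 := by
  have hsurj : ∀ z : JBK ι π L hL, ∃ y, Submodule.Quotient.mk y = z := fun z =>
    Submodule.Quotient.mk_surjective _ z
  have hf : H1f ι π L hL = ⊥ := by rw [H1f, hV, Submodule.map_bot]
  let v : LinearMap.ker (hMap ι π L hL) :=
    ⟨Submodule.Quotient.mk x, (hMap_mk_eq_zero_iff ι π L hL hpl x).2 hx⟩
  refine rank_torsionBy_eq_one v ?_ ?_ ?_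
  · intro h
    have h2 : (Submodule.Quotient.mk x : JBK ι π L hL) = 0 := congrArg Subtype.val h
    have h3 : x ∈ H1f ι π L hL := (Submodule.Quotient.mk_eq_zero _).1 h2
    rw [hf, Submodule.mem_bot] at h3
    exact hx0 h3
  · exact Subtype.ext ((map_nsmul (H1f ι π L hL).mkQ p x).symm.trans
      ((congrArg _ hpx).trans (map_zero _)))
  · intro t
    obtain ⟨y, hy⟩ := hsurj t.1
    have hy0 : hMap ι π L hL (Submodule.Quotient.mk y) = 0 := by
      rw [hy]; exact t.2
    obtain ⟨n, hn⟩ := hall y ((hMap_mk_eq_zero_iff ι π L hL hpl y).1 hy0)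
    exact ⟨n, Subtype.ext ((map_nsmul (H1f ι π L hL).mkQ n x).symm.trans
      ((congrArg Submodule.Quotient.mk hn).symm.trans hy))⟩

end DeltaRank

/-! ## Matrices congruent to the identity modulo `p` -/

section Matrices

variable {p : ℕ} [Fact p.Prime]

theorem dvd_iff_toZMod_eq_zero {a : ℤ_[p]} : (p : ℤ_[p]) ∣ a ↔ PadicInt.toZMod a = 0 := by
  rw [← RingHom.mem_ker, PadicInt.ker_toZMod, PadicInt.maximalIdeal_eq_span_p,
    Ideal.mem_span_singleton]

theorem dvd_apply_sub_of_redGL_eq {u w : GL (Fin 2) ℤ_[p]} (h : redGL p u = redGL p w)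
    (i j : Fin 2) : (p : ℤ_[p]) ∣ u.1 i j - w.1 i j := by
  rw [dvd_iff_toZMod_eq_zero, map_sub, sub_eq_zero]
  exact congrArg (fun t : GL (Fin 2) (ZMod p) => t.1 i j) h

theorem redGL_one_apply {u : GL (Fin 2) ℤ_[p]} (h : redGL p u = 1) (i j : Fin 2) :
    (p : ℤ_[p]) ∣ u.1 i j - (1 : Matrix (Fin 2) (Fin 2) ℤ_[p]) i j :=
  dvd_apply_sub_of_redGL_eq (h.trans (map_one (redGL p)).symm) i j

/-- `(1 + pX)^(p^k) ≡ 1` mod `p^(k+1)`; hence the images modulo powers of `p` are `p`-groups, as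
needed to exploit a pro-`p` generator. -/
theorem map_pow_eq_one_of_redGL_eq_one {u : GL (Fin 2) ℤ_[p]} (h : redGL p u = 1) (k : ℕ) :
    Matrix.GeneralLinearGroup.map (PadicInt.toZModPow (p := p) (k + 1)) (u ^ p ^ k) = 1 := by
  choose X hX using redGL_one_apply h
  have hu : u.1 = 1 + (p : ℤ_[p]) • Matrix.of X := by
    ext i j
    have := hX i j
    simp [← this]
  -- The congruence is proved in the commutative ring `ℤ_p[X]` and then evaluated at the matrix.
  have hdvd : ((p : Polynomial ℤ_[p]) ^ (k + 1)) ∣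
      (1 + (p : Polynomial ℤ_[p]) * Polynomial.X) ^ p ^ k - 1 ^ p ^ k :=
    dvd_sub_pow_of_dvd_sub (by rw [add_sub_cancel_left]; exact dvd_mul_right _ _) k
  obtain ⟨Q, hQ⟩ := hdvd
  have h1 := congrArg (Polynomial.aeval (Matrix.of X)) hQ
  simp only [one_pow, map_sub, map_pow, map_add, map_one, map_mul, map_natCast,
    Polynomial.aeval_X] at h1
  have h2 : u.1 ^ p ^ k = 1 + ((p : ℤ_[p]) ^ (k + 1)) • Polynomial.aeval (Matrix.of X) Q := by
    have h3 : ∀ M : Matrix (Fin 2) (Fin 2) ℤ_[p], ∀ n : ℕ,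
        ((p : Matrix (Fin 2) (Fin 2) ℤ_[p]) ^ n) * M = ((p : ℤ_[p]) ^ n) • M := by
      intro M n
      rw [← nsmul_one, smul_pow, one_pow, smul_mul_assoc, one_mul, ← Nat.cast_smul_eq_nsmul ℤ_[p]]
      push_cast
      rfl
    rw [h3, sub_eq_iff_eq_add'] at h1
    rw [← h1, hu]
    congr 2
    have := h3 (Matrix.of X) 1
    rw [pow_one, pow_one] at this
    exact this.symm
  apply Units.ext
  ext i j
  change PadicInt.toZModPow (k + 1) ((u.1 ^ p ^ k) i j) = (1 : Matrix (Fin 2) (Fin 2) _) i j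
  have hp0 : PadicInt.toZModPow (k + 1) ((p : ℤ_[p]) ^ (k + 1)) = 0 := by
    rw [← RingHom.mem_ker, PadicInt.ker_toZModPow]
    exact Ideal.mem_span_singleton_self _
  rw [h2, Matrix.add_apply, Matrix.smul_apply, smul_eq_mul, map_add, map_mul, hp0, zero_mul,
    add_zero, Matrix.one_apply, Matrix.one_apply]
  split_ifs <;> simp

/-- The upper unipotent matrices. -/
def unipotent (R : Type*) [CommRing R] : Subgroup (GL (Fin 2) R) where
  carrier := {u | ∃ z, u.1 = !![1, z; 0, 1]}
  one_mem' := ⟨0, by simp [Matrix.one_fin_two]⟩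
  mul_mem' := by
    rintro a b ⟨y, hy⟩ ⟨z, hz⟩
    exact ⟨z + y, by rw [Units.val_mul, hy, hz]; simp⟩
  inv_mem' := by
    rintro a ⟨y, hy⟩
    refine ⟨-y, ?_⟩
    have h : a * ⟨!![1, -y; 0, 1], !![1, y; 0, 1], by simp [Matrix.one_fin_two],
        by simp [Matrix.one_fin_two]⟩ = 1 := by
      apply Units.ext
      rw [Units.val_mul, hy]
      simp [Matrix.one_fin_two]
    rw [inv_eq_of_mul_eq_one_right h]

theorem continuous_toZModPow (n : ℕ) :
    Continuous (PadicInt.toZModPow (p := p) n : ℤ_[p] → ZMod (p ^ n)) := by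
  refine continuous_of_continuousAt_zero (PadicInt.toZModPow (p := p) n) ?_
  rw [ContinuousAt, map_zero, nhds_discrete (ZMod (p ^ n)), Filter.tendsto_pure]
  have hp0 : (0 : ℝ) < p := by exact_mod_cast (Fact.out : p.Prime).pos
  refine Filter.mem_of_superset (Metric.closedBall_mem_nhds 0 (zpow_pos hp0 (-n : ℤ))) ?_
  intro x hx
  rw [mem_closedBall_zero_iff, PadicInt.norm_le_pow_iff_mem_span_pow] at hx
  rw [Set.mem_ofPred_eq, ← RingHom.mem_ker, PadicInt.ker_toZModPow]
  exact hx

theorem isOpen_ker_map {G : Type*} [Group G] [TopologicalSpace G] (φ : G →* GL (Fin 2) ℤ_[p])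
    (hφ : Continuous φ) (n : ℕ) :
    IsOpen (((Matrix.GeneralLinearGroup.map (PadicInt.toZModPow (p := p) n)).comp φ).ker :
      Set G) := by
  have : (((Matrix.GeneralLinearGroup.map (PadicInt.toZModPow (p := p) n)).comp φ).ker : Set G) =
      ⋂ a : Fin 2, ⋂ b : Fin 2, (fun i : G => PadicInt.toZModPow n ((φ i).1 a b)) ⁻¹'
        {(1 : Matrix (Fin 2) (Fin 2) (ZMod (p ^ n))) a b} := by
    ext i
    rw [SetLike.mem_coe, MonoidHom.mem_ker, Units.ext_iff, ← Matrix.ext_iff]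
    simp only [Set.mem_iInter, Set.mem_preimage, Set.mem_singleton_iff, MonoidHom.comp_apply,
      Matrix.GeneralLinearGroup.map_apply, Units.val_one]
  rw [this]
  refine isOpen_iInter_of_finite fun a => isOpen_iInter_of_finite fun b =>
    (isOpen_discrete _).preimage ?_
  exact (continuous_toZModPow n).comp
    ((Units.continuous_val.comp hφ).matrix_elem a b)

theorem exists_index_ker_map_eq_pow {G : Type*} [Group G] (φ : G →* GL (Fin 2) ℤ_[p])
    (hred : ∀ g, redGL p (φ g) = 1) (k : ℕ) :
    ∃ m : ℕ, ((Matrix.GeneralLinearGroup.map (PadicInt.toZModPow (p := p) (k + 1))).comp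
      φ).ker.index = p ^ m := by
  rw [Subgroup.index_ker]
  refine IsPGroup.iff_card.1 ?_
  rintro ⟨u, hu⟩
  obtain ⟨i, hi⟩ := hu
  have hpow : u ^ p ^ k = 1 := by
    rw [← hi, MonoidHom.comp_apply, ← map_pow]
    exact map_pow_eq_one_of_redGL_eq_one (hred i) k
  exact ⟨k, Subtype.ext hpow⟩

variable {ℓ : ℕ} [Fact ℓ.Prime]

theorem IsProPGenerator.map_mem_of_ker {p : ℕ} {τ : GalQl ℓ} (hτ : IsProPGenerator p τ) {H : Type*}
    [Group H] (f : inertia ℓ →* H) (hf : IsOpen (f.ker : Set (inertia ℓ)))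
    (hf' : ∃ m, f.ker.index = p ^ m) (S : Subgroup H) (hS : ∀ h, f ⟨τ, h⟩ ∈ S) (i : inertia ℓ) :
    f i ∈ S := by
  obtain ⟨hτI, h⟩ := hτ
  have h2 : Subgroup.zpowers (⟨τ, hτI⟩ : inertia ℓ) ⊔ f.ker ≤ S.comap f :=
    sup_le (Subgroup.zpowers_le.2 (hS hτI)) (Subgroup.ker_le_comap _ _)
  rw [h _ inferInstance hf hf'] at h2
  exact h2 (Subgroup.mem_top i)

/-- The image of inertia under a representation congruent to the identity modulo `p` is
topologically generated by the image of a generator of the pro-`p` quotient. -/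
theorem IsProPGenerator.map_mem {τ : GalQl ℓ} (hτ : IsProPGenerator p τ)
    (φ : GalQl ℓ →* GL (Fin 2) ℤ_[p]) (hφ : Continuous φ) (hred : ∀ g, redGL p (φ g) = 1) (k : ℕ)
    (S : Subgroup (GL (Fin 2) (ZMod (p ^ (k + 1)))))
    (hS : Matrix.GeneralLinearGroup.map (PadicInt.toZModPow (p := p) (k + 1)) (φ τ) ∈ S)
    {i : GalQl ℓ} (hi : i ∈ inertia ℓ) :
    Matrix.GeneralLinearGroup.map (PadicInt.toZModPow (p := p) (k + 1)) (φ i) ∈ S := by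
  have hψ : Continuous (φ.comp (inertia ℓ).subtype) := by
    rw [MonoidHom.coe_comp, Subgroup.coe_subtype]
    exact hφ.comp continuous_subtype_val
  have hψred : ∀ g, redGL p (φ.comp (inertia ℓ).subtype g) = 1 := fun g => by
    rw [MonoidHom.comp_apply]
    exact hred _
  have h := hτ.map_mem_of_ker ((Matrix.GeneralLinearGroup.map (PadicInt.toZModPow (p := p)
    (k + 1))).comp (φ.comp (inertia ℓ).subtype)) (isOpen_ker_map _ hψ (k + 1))
    (exists_index_ker_map_eq_pow _ hψred k) S (fun _ => hS) ⟨i, hi⟩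
  exact h

/-- Modulo each `p^(k+1)` the image of `i` is a power of that of `τ`, hence unipotent; the entries
are recovered from all these reductions. -/
theorem IsProPGenerator.eq_unipotent {τ : GalQl ℓ} (hτ : IsProPGenerator p τ)
    (φ : GalQl ℓ →* GL (Fin 2) ℤ_[p]) (hφ : Continuous φ) (hred : ∀ g, redGL p (φ g) = 1)
    {y : ℤ_[p]} (hy : (φ τ).1 = !![1, y; 0, 1]) {i : GalQl ℓ} (hi : i ∈ inertia ℓ) :
    (φ i).1 = !![1, (φ i).1 0 1; 0, 1] := by
  have key : ∀ k, ∃ z, ((φ i).1.map (PadicInt.toZModPow (p := p) (k + 1))) = !![1, z; 0, 1] :=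
    fun k => hτ.map_mem φ hφ hred k (unipotent _)
      ⟨PadicInt.toZModPow (k + 1) y, by
        change (φ τ).1.map (PadicInt.toZModPow (p := p) (k + 1)) = _
        rw [hy]
        ext a b
        fin_cases a <;> fin_cases b <;> simp⟩ hi
  have h : ∀ a b : Fin 2, ∀ t : ℤ_[p], (∀ k, PadicInt.toZModPow (k + 1) ((φ i).1 a b) =
      PadicInt.toZModPow (k + 1) t) → (φ i).1 a b = t := by
    intro a b t ht
    refine PadicInt.ext_of_toZModPow.1 fun n => ?_
    have := congrArg (ZMod.castHom (pow_dvd_pow p n.le_succ) (ZMod (p ^ n))) (ht n)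
    rwa [← RingHom.comp_apply, ← RingHom.comp_apply,
      PadicInt.zmod_cast_comp_toZModPow n (n + 1) n.le_succ] at this
  ext a b
  fin_cases a <;> fin_cases b
  · refine h 0 0 1 fun k => ?_
    obtain ⟨z, hz⟩ := key k
    simpa using congrFun (congrFun hz 0) 0
  · rfl
  · refine h 1 0 0 fun k => ?_
    obtain ⟨z, hz⟩ := key k
    simpa using congrFun (congrFun hz 1) 0
  · refine h 1 1 1 fun k => ?_
    obtain ⟨z, hz⟩ := key k
    simpa using congrFun (congrFun hz 1) 1

end Matrices

/-! ## Coordinates on `V` with respect to a basis of `T` -/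

section Basis

variable {p : ℕ} [Fact p.Prime]

/-- The coordinates on `V` with respect to the columns of `D ∈ GL₂(ℤ_p)`. -/
def coords (D : GL (Fin 2) ℤ_[p]) : ℚ_[p] × ℚ_[p] ≃+ V p where
  toFun s := (Matrix.GeneralLinearGroup.map (algebraMap ℤ_[p] ℚ_[p]) D).1.mulVec ![s.1, s.2]
  invFun v :=
    ((Matrix.GeneralLinearGroup.map (algebraMap ℤ_[p] ℚ_[p]) D⁻¹).1.mulVec v 0,
      (Matrix.GeneralLinearGroup.map (algebraMap ℤ_[p] ℚ_[p]) D⁻¹).1.mulVec v 1)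
  left_inv s := by
    simp only [Matrix.mulVec_mulVec, ← Units.val_mul, ← map_mul, inv_mul_cancel, map_one,
      Units.val_one, Matrix.one_mulVec]
    rfl
  right_inv v := by
    have : ∀ w : V p, ![w 0, w 1] = w := fun w => by
      ext i; fin_cases i <;> rfl
    simp only [this, Matrix.mulVec_mulVec, ← Units.val_mul, ← map_mul, mul_inv_cancel, map_one,
      Units.val_one, Matrix.one_mulVec]
  map_add' s t := by
    rw [← Matrix.mulVec_add]
    congr 1
    ext i; fin_cases i <;> rfl

theorem coords_zero (D : GL (Fin 2) ℤ_[p]) (a b : ℚ_[p]) :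
    coords D (a, b) 0 = D.1 0 0 * a + D.1 0 1 * b := by
  simp [coords, Matrix.mulVec, dotProduct, Fin.sum_univ_two]

theorem coords_one (D : GL (Fin 2) ℤ_[p]) (a b : ℚ_[p]) :
    coords D (a, b) 1 = D.1 1 0 * a + D.1 1 1 * b := by
  simp [coords, Matrix.mulVec, dotProduct, Fin.sum_univ_two]

theorem coords_symm (D : GL (Fin 2) ℤ_[p]) (v : V p) :
    (coords D).symm v = ((D⁻¹).1 0 0 * v 0 + (D⁻¹).1 0 1 * v 1,
      (D⁻¹).1 1 0 * v 0 + (D⁻¹).1 1 1 * v 1) := by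
  have h : ∀ i, (Matrix.GeneralLinearGroup.map (algebraMap ℤ_[p] ℚ_[p]) D⁻¹).1.mulVec v i =
      (D⁻¹).1 i 0 * v 0 + (D⁻¹).1 i 1 * v 1 := fun i => Fin.sum_univ_two _
  exact Prod.ext (h 0) (h 1)

theorem continuous_coords (D : GL (Fin 2) ℤ_[p]) : Continuous (coords D) := by
  refine continuous_pi fun i => ?_
  fin_cases i
  · change Continuous fun s : ℚ_[p] × ℚ_[p] => coords D (s.1, s.2) 0
    simp only [coords_zero]
    fun_prop
  · change Continuous fun s : ℚ_[p] × ℚ_[p] => coords D (s.1, s.2) 1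
    simp only [coords_one]
    fun_prop

/-- Base change to the columns of `D`, with the scalar `w` of the twist kept separate from the
matrix `u`. -/
theorem repV_coords {G : Type*} [Group G] (R : G →* GL (Fin 2) ℤ_[p]) (D : GL (Fin 2) ℤ_[p])
    (g : G) {w : ℤ_[p]} {u : Matrix (Fin 2) (Fin 2) ℤ_[p]} (h : (R g).1 * D.1 = w • (D.1 * u))
    (a b : ℚ_[p]) : repV R g (coords D (a, b)) =
      coords D (w * (u 0 0 * a + u 0 1 * b), w * (u 1 0 * a + u 1 1 * b)) := by
  have h1 : ∀ i j, (R g).1 i 0 * D.1 0 j + (R g).1 i 1 * D.1 1 j =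
      w * (D.1 i 0 * u 0 j + D.1 i 1 * u 1 j) := fun i j => by
    have := congrFun (congrFun h i) j
    simpa [Matrix.mul_apply, Fin.sum_univ_two] using this
  have h2 : ∀ i j, ((R g).1 i 0 : ℚ_[p]) * D.1 0 j + (R g).1 i 1 * D.1 1 j =
      w * (D.1 i 0 * u 0 j + D.1 i 1 * u 1 j) := fun i j => by
    have := congrArg (fun t : ℤ_[p] => (t : ℚ_[p])) (h1 i j)
    push_cast at this
    exact this
  have h3 : ∀ i, repV R g (coords D (a, b)) i =
      (R g).1 i 0 * (D.1 0 0 * a + D.1 0 1 * b) + (R g).1 i 1 * (D.1 1 0 * a + D.1 1 1 * b) := by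
    intro i
    rw [← coords_zero, ← coords_one]
    simp [repV, Matrix.mulVec, dotProduct, Fin.sum_univ_two]
  ext i
  fin_cases i
  · change repV R g (coords D (a, b)) 0 = coords D _ 0
    rw [h3, coords_zero]
    linear_combination a * h2 0 0 + b * h2 0 1
  · change repV R g (coords D (a, b)) 1 = coords D _ 1
    rw [h3, coords_one]
    linear_combination a * h2 1 0 + b * h2 1 1

theorem mem_latT_iff {v : V p} : v ∈ latT p ↔ ‖v 0‖ ≤ 1 ∧ ‖v 1‖ ≤ 1 := by
  have h : ∀ a b : ℤ_[p], a • (![1, 0] : V p) + b • ![0, 1] = ![(a : ℚ_[p]), (b : ℚ_[p])] := by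
    intro a b
    ext i
    fin_cases i <;> simp [Algebra.smul_def]
  rw [latT, Submodule.mem_span_pair]
  simp only [h]
  constructor
  · rintro ⟨a, b, rfl⟩
    exact ⟨a.2, b.2⟩
  · rintro ⟨h0, h1⟩
    refine ⟨⟨_, h0⟩, ⟨_, h1⟩, ?_⟩
    ext i
    fin_cases i <;> rfl

theorem mem_latT'_iff {v : V p} : v ∈ latT' p ↔ ‖(p : ℚ_[p]) * v 0‖ ≤ 1 ∧ ‖v 1‖ ≤ 1 := by
  have hp0 : (p : ℚ_[p]) ≠ 0 := by exact_mod_cast (Fact.out : p.Prime).ne_zero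
  have h : ∀ a b : ℤ_[p], a • (![(p : ℚ_[p])⁻¹, 0] : V p) + b • ![0, 1] =
      ![(a : ℚ_[p]) / p, (b : ℚ_[p])] := by
    intro a b
    ext i
    fin_cases i <;> simp [Algebra.smul_def, div_eq_mul_inv]
  rw [latT', Submodule.mem_span_pair]
  simp only [h]
  constructor
  · rintro ⟨a, b, rfl⟩
    refine ⟨?_, b.2⟩
    have : (p : ℚ_[p]) * (a / p) = a := by field_simp
    exact (congrArg norm this).trans_le a.2
  · rintro ⟨h0, h1⟩
    refine ⟨⟨_, h0⟩, ⟨_, h1⟩, ?_⟩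
    ext i
    fin_cases i
    · exact mul_div_cancel_left₀ _ hp0
    · rfl

theorem isClosed_latT : IsClosed (latT p : Set (V p)) := by
  have : (latT p : Set (V p)) = {v | ‖v 0‖ ≤ 1} ∩ {v | ‖v 1‖ ≤ 1} := by
    ext v; exact mem_latT_iff
  rw [this]
  exact (isClosed_le (by fun_prop) continuous_const).inter
    (isClosed_le (by fun_prop) continuous_const)

theorem isClosed_latT' : IsClosed (latT' p : Set (V p)) := by
  have : (latT' p : Set (V p)) = {v | ‖(p : ℚ_[p]) * v 0‖ ≤ 1} ∩ {v | ‖v 1‖ ≤ 1} := by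
    ext v; exact mem_latT'_iff
  rw [this]
  exact (isClosed_le (by fun_prop) continuous_const).inter
    (isClosed_le (by fun_prop) continuous_const)

theorem t1Space_quotient {L : Submodule ℤ_[p] (V p)} (hL : IsClosed (L : Set (V p))) :
    T1Space (V p ⧸ L) := by
  have : IsClosed (L : Set (V p)) := hL
  have := Submodule.t3_quotient_of_isClosed (R := ℤ_[p]) (S := L) (M := V p)
  infer_instance

theorem norm_mul_add_le_one (r s : ℤ_[p]) {a b : ℚ_[p]} (ha : ‖a‖ ≤ 1) (hb : ‖b‖ ≤ 1) :
    ‖(r : ℚ_[p]) * a + s * b‖ ≤ 1 :=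
  (PadicInt.subring p).add_mem ((PadicInt.subring p).mul_mem r.2 ha)
    ((PadicInt.subring p).mul_mem s.2 hb)

theorem coords_mem_latT_iff (D : GL (Fin 2) ℤ_[p]) (a b : ℚ_[p]) :
    coords D (a, b) ∈ latT p ↔ ‖a‖ ≤ 1 ∧ ‖b‖ ≤ 1 := by
  rw [mem_latT_iff]
  constructor
  · rintro ⟨h0, h1⟩
    have h := coords_symm D (coords D (a, b))
    rw [AddEquiv.symm_apply_apply, Prod.mk.injEq] at h
    exact ⟨(congrArg norm h.1).trans_le (norm_mul_add_le_one _ _ h0 h1),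
      (congrArg norm h.2).trans_le (norm_mul_add_le_one _ _ h0 h1)⟩
  · rintro ⟨ha, hb⟩
    rw [coords_zero, coords_one]
    exact ⟨norm_mul_add_le_one _ _ ha hb, norm_mul_add_le_one _ _ ha hb⟩

/-- The bottom row of `D` is `(1, 1)` mod `p`, so the `e₂`-coordinate is `a + b` up to multiples of
`pa` and `pb`, both of which are integral on `T' ⊆ p⁻¹T`. -/
theorem coords_mem_latT'_iff {D : GL (Fin 2) ℤ_[p]}
    (h10 : (p : ℤ_[p]) ∣ D.1 1 0 - 1) (h11 : (p : ℤ_[p]) ∣ D.1 1 1 - 1) (a b : ℚ_[p]) :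
    coords D (a, b) ∈ latT' p ↔ ‖a + b‖ ≤ 1 ∧ ‖(p : ℚ_[p]) * b‖ ≤ 1 := by
  have hadd : ∀ {s t : ℚ_[p]}, ‖s‖ ≤ 1 → ‖t‖ ≤ 1 → ‖s + t‖ ≤ 1 := fun hs ht =>
    (Padic.nonarchimedean _ _).trans (max_le hs ht)
  have hsub : ∀ {s t : ℚ_[p]}, ‖s‖ ≤ 1 → ‖t‖ ≤ 1 → ‖s - t‖ ≤ 1 := fun hs ht => by
    rw [sub_eq_add_neg]; exact hadd hs (by rwa [norm_neg])
  have hp1 : ‖(p : ℚ_[p])‖ ≤ 1 := Padic.norm_p_lt_one.le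
  rw [mem_latT'_iff]
  have h1 : coords D (a, b) 1 =
      (a + b) + (((D.1 1 0 - 1 : ℤ_[p]) : ℚ_[p]) * a + ((D.1 1 1 - 1 : ℤ_[p]) : ℚ_[p]) * b) := by
    rw [coords_one]; push_cast; ring
  have h0 : (p : ℚ_[p]) * coords D (a, b) 0 = D.1 0 0 * (p * a) + D.1 0 1 * (p * b) := by
    rw [coords_zero]; ring
  constructor
  · rintro ⟨hv0, hv1⟩
    have hT : coords D ((p : ℚ_[p]) * a, (p : ℚ_[p]) * b) ∈ latT p := by
      rw [mem_latT_iff, coords_zero, ← h0, coords_one]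
      refine ⟨hv0, ?_⟩
      have : (D.1 1 0 : ℚ_[p]) * (p * a) + D.1 1 1 * (p * b) = p * coords D (a, b) 1 := by
        rw [coords_one]; ring
      rw [this, norm_mul]
      exact mul_le_one₀ hp1 (norm_nonneg _) hv1
    obtain ⟨ha, hb⟩ := (coords_mem_latT_iff D _ _).1 hT
    refine ⟨?_, hb⟩
    rw [← sub_eq_iff_eq_add] at h1
    rw [← h1]
    exact hsub hv1 (hadd (norm_mul_le_one_of_dvd h10 ha) (norm_mul_le_one_of_dvd h11 hb))
  · rintro ⟨hab, hb⟩
    have ha : ‖(p : ℚ_[p]) * a‖ ≤ 1 := by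
      have : (p : ℚ_[p]) * a = p * (a + b) - p * b := by ring
      rw [this]
      refine hsub ?_ hb
      rw [norm_mul]
      exact mul_le_one₀ hp1 (norm_nonneg _) hab
    rw [h0, h1]
    exact ⟨norm_mul_add_le_one _ _ ha hb,
      hadd hab (hadd (norm_mul_le_one_of_dvd h10 ha) (norm_mul_le_one_of_dvd h11 hb))⟩

end Basis

/-! ### The Teichmüller twist -/

section Twist

variable {p : ℕ} [Fact p.Prime]

theorem continuous_teichLift {β : GalQ →* (ZMod p)ˣ} (hβ : Continuous β) :
    Continuous (teichLift β) := by
  have : DiscreteTopology (ZMod p)ˣ := inferInstance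
  exact (continuous_of_discreteTopology (f := Units.map
    ((WittVector.equiv p).toMonoidHom.comp
      (WittVector.teichmuller p : ZMod p →* WittVector p (ZMod p))))).comp hβ

theorem teichLift_pow (β : GalQ →* (ZMod p)ˣ) (g : GalQ) : teichLift β g ^ (p - 1) = 1 := by
  rw [teichLift, MonoidHom.comp_apply, ← map_pow, ZMod.units_pow_card_sub_one_eq_one, map_one]

theorem teichLift_eq_one {β : GalQ →* (ZMod p)ˣ} {g : GalQ} (h : β g = 1) :
    teichLift β g = 1 := by
  rw [teichLift, MonoidHom.comp_apply, h, map_one]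

theorem twist_val (ρ : GalQ →* GL (Fin 2) ℤ_[p]) (β : GalQ →* (ZMod p)ˣ) (g : GalQ) :
    (twist ρ β g).1 = ((teichLift β g)⁻¹ : ℤ_[p]ˣ).1 • (ρ g).1 :=
  rfl

theorem continuous_repV_twist {ρ : GalQ →* GL (Fin 2) ℤ_[p]} (hρ : Continuous ρ)
    {β : GalQ →* (ZMod p)ˣ} (hβ : Continuous β) (v : V p) :
    Continuous fun g => repV (twist ρ β) g v := by
  have h1 : ∀ i j, Continuous fun g => (twist ρ β g).1 i j := fun i j => by
    simp only [twist_val, Matrix.smul_apply, smul_eq_mul]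
    exact (Units.continuous_val.comp (continuous_teichLift hβ).inv).mul
      ((Units.continuous_val.comp hρ).matrix_elem i j)
  have h2 : ∀ g i, repV (twist ρ β) g v i =
      ((twist ρ β g).1 i 0 : ℚ_[p]) * v 0 + ((twist ρ β g).1 i 1 : ℚ_[p]) * v 1 := fun g i => by
    simp [repV, Matrix.mulVec, dotProduct, Fin.sum_univ_two]
  refine continuous_pi fun i => ?_
  simp only [h2]
  exact ((continuous_subtype_val.comp (h1 i 0)).mul continuous_const).add
    ((continuous_subtype_val.comp (h1 i 1)).mul continuous_const)

end Twist

/-! ### Local normal form at a Type III prime -/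

section LocalForm

variable {p : ℕ} [Fact p.Prime] {ℓ : ℕ} [Fact ℓ.Prime]

/-- A residually trivial Type III representation in the basis in which it is upper triangular. -/
theorem IsTypeIII.exists_conj {σ τ : GalQl ℓ} {φ : GalQl ℓ →* GL (Fin 2) ℤ_[p]}
    (h : IsTypeIII σ τ φ) (hφ : Continuous φ) (hred : ∀ g, redGL p (φ g) = 1) :
    ∃ (D : GL (Fin 2) ℤ_[p]) (U : GalQl ℓ →* GL (Fin 2) ℤ_[p]) (x y : ℤ_[p]),
      redGL p D = redGL p (matB p) ∧ Continuous U ∧ (∀ g, redGL p (U g) = 1) ∧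
      (∀ g, φ g * D = D * U g) ∧ (p : ℤ_[p]) ∣ y ∧ ¬ (p : ℤ_[p]) ^ 2 ∣ y ∧
      (U σ).1 = !![(ℓ : ℤ_[p]), x; 0, 1] ∧ (U τ).1 = !![1, y; 0, 1] := by
  obtain ⟨ϱ', ⟨C, hC, x, y, -, hy, hy2, hσ, hτ⟩, hφ'⟩ := h
  -- The new basis is `matB · C⁻¹`; as `C ≡ 1` mod `p`, it reduces to `matB`, which fixes the
  -- position of `T'` relative to it.
  have hU : ∀ g, (matB p * C⁻¹)⁻¹ * φ g * (matB p * C⁻¹) = C * ϱ' g * C⁻¹ := fun g => by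
    rw [hφ']; group
  refine ⟨matB p * C⁻¹, (MulAut.conj (matB p * C⁻¹)⁻¹).toMonoidHom.comp φ, x, y, ?_, ?_, ?_, ?_,
    hy, hy2, ?_, ?_⟩
  · rw [map_mul, map_inv, MonoidHom.mem_ker.1 hC, inv_one, mul_one]
  · simp only [MonoidHom.coe_comp]
    refine Continuous.comp ?_ hφ
    change Continuous fun g => (matB p * C⁻¹)⁻¹ * g * ((matB p * C⁻¹)⁻¹)⁻¹
    exact (continuous_const.mul continuous_id).mul continuous_const
  · intro g
    rw [MonoidHom.comp_apply, MulEquiv.coe_toMonoidHom, MulAut.conj_apply, map_mul, map_mul, hred,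
      mul_one, ← map_mul, mul_inv_cancel, map_one]
  · intro g
    rw [MonoidHom.comp_apply, MulEquiv.coe_toMonoidHom, MulAut.conj_apply]
    group
  · rw [MonoidHom.comp_apply, MulEquiv.coe_toMonoidHom, MulAut.conj_apply, inv_inv, hU]
    exact hσ
  · rw [MonoidHom.comp_apply, MulEquiv.coe_toMonoidHom, MulAut.conj_apply, inv_inv, hU]
    exact hτ

theorem natCast_dvd_sub_one {ℓ : ℕ} (hℓ : ℓ ≡ 1 [MOD p]) : (p : ℤ_[p]) ∣ (ℓ : ℤ_[p]) - 1 := by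
  have := (Nat.modEq_iff_dvd.1 hℓ.symm)
  have h := (PadicInt.pow_p_dvd_int_iff (p := p) 1 ((ℓ : ℤ) - 1)).2 (by simpa using this)
  simpa using h

theorem not_sq_dvd_natCast_sub_one {ℓ : ℕ} (hℓ : ¬ ℓ ≡ 1 [MOD p ^ 2]) :
    ¬ (p : ℤ_[p]) ^ 2 ∣ (ℓ : ℤ_[p]) - 1 := by
  intro h
  have h1 := (PadicInt.pow_p_dvd_int_iff (p := p) 2 ((ℓ : ℤ) - 1)).1 (by simpa using h)
  exact hℓ (Nat.modEq_iff_dvd.2 (by simpa using h1)).symm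

end LocalForm

end TypeThree

end

/-! ### The theorem -/

open TypeThree in
theorem mainTheorem11 (p : ℕ) [Fact p.Prime] (hp : 5 ≤ p)
    (ρbar : GalQ →* GL (Fin 2) (ZMod p)) (β : GalQ →* (ZMod p)ˣ) (hβ : Continuous β)
    (hbar : ∀ g, ∃ b, (ρbar g).1 = !![PadicInt.toZMod (cycChar p g).1 * (β g).1 ^ 2, b; 0, 1])
    (ρ : GalQ →* GL (Fin 2) ℤ_[p]) (hρ : Continuous ρ) (hlift : ∀ g, redGL p (ρ g) = ρbar g)
    (ℓ : ℕ) [Fact ℓ.Prime] (ι : AlgebraicClosure ℚ →+* PadicAlgCl ℓ)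
    (hℓ : IsTrivialPrime ι ρbar)
    (σ τ : GalQl ℓ) (hσ : IsFrobenius σ) (hτ : IsProPGenerator p τ)
    (hIII : IsTypeIII σ τ (ρ.comp (decomp ι))) :
    delta ι (repV (twist ρ β)) (latT' p)
        (latT'_stable (twist_lower β hlift fun g => by obtain ⟨b, hb⟩ := hbar g; simp [hb])) = 0 ∧
    ((∀ g : GalQl ℓ, β (decomp ι g) = 1) →
      delta ι (repV (twist ρ β)) (latT p) (latT_stable (twist ρ β)) = 1 ∧
      Finite (H0 ι (repV (twist ρ β)) (latT p) (latT_stable (twist ρ β)))) := by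
  obtain ⟨hℓ1, hℓ2, hρbar⟩ := hℓ
  -- If `ℓ = p`, then `ℓ ≡ 1` would make `p` divide `p - 1`.
  have hpl : p ≠ ℓ := by
    rintro rfl
    have h1 := (Nat.modEq_iff_dvd' (Fact.out : p.Prime).one_le).1 hℓ1.symm
    exact absurd (Nat.le_of_dvd (by omega) h1) (by omega)
  have hred : ∀ g, redGL p (ρ.comp (decomp ι) g) = 1 := fun g => (hlift _).trans (hρbar g)
  have hφ : Continuous (ρ.comp (decomp ι)) := by
    rw [MonoidHom.coe_comp]
    exact hρ.comp (continuous_decomp ι)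
  obtain ⟨D, U, x, y, hD, hU, hUred, hconj, hy, hy2, hUσ, hUτ⟩ := hIII.exists_conj hφ hred
  have hUI : ∀ i ∈ inertia ℓ, (U i).1 = !![1, (U i).1 0 1; 0, 1] := fun i hi =>
    hτ.eq_unipotent U hU hUred hUτ hi
  have hU01 : ∀ g, (p : ℤ_[p]) ∣ (U g).1 0 1 := fun g => by
    simpa using redGL_one_apply (hUred g) 0 1
  let ω : GalQl ℓ → ℤ_[p] := fun g => ((teichLift β (decomp ι g))⁻¹ : ℤ_[p]ˣ).1
  have hω : ∀ g, ω g ^ (p - 1) = 1 := fun g => by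
    rw [← Units.val_pow_eq_pow_val, inv_pow, teichLift_pow, inv_one, Units.val_one]
  have hact : ∀ g a b, repV (twist ρ β) (decomp ι g) (coords D (a, b)) =
      coords D (ω g * ((U g).1 0 0 * a + (U g).1 0 1 * b),
        ω g * ((U g).1 1 0 * a + (U g).1 1 1 * b)) := fun g a b => by
    refine repV_coords _ _ _ ?_ a b
    rw [twist_val, smul_mul_assoc]
    exact congrArg (ω g • ·) (congrArg Units.val (hconj g))
  have hactI : ∀ i ∈ inertia ℓ, ∀ a b, repV (twist ρ β) (decomp ι i) (coords D (a, b)) =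
      coords D (ω i * (a + (U i).1 0 1 * b), ω i * b) := fun i hi a b => by
    have h := hact i a b
    rw [hUI i hi] at h
    simpa using h
  have hactσ : ∀ a b, repV (twist ρ β) (decomp ι σ) (coords D (a, b)) =
      coords D (ω σ * (((ℓ : ℤ_[p]) : ℚ_[p]) * a + x * b), ω σ * b) := fun a b => by
    have h := hact σ a b
    rw [hUσ] at h
    simpa using h
  have hactτ : ∀ a b, repV (twist ρ β) (decomp ι τ) (coords D (a, b)) =
      coords D (ω τ * (a + y * b), ω τ * b) := fun a b => by
    have h := hact τ a b
    rw [hUτ] at h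
    simpa using h
  have hcontV : ∀ v, Continuous fun g => repV (twist ρ β) (decomp ι g) v := fun v =>
    (continuous_repV_twist hρ hβ v).comp (continuous_decomp ι)
  have hq : (ℓ : ℤ_[p]) ^ (p - 1) ≠ 1 := by
    have h1 : 1 < ℓ ^ (p - 1) := Nat.one_lt_pow (by omega) (Fact.out : ℓ.Prime).one_lt
    exact_mod_cast h1.ne'
  have hq1 : (ℓ : ℤ_[p]) ≠ 1 := fun h => hq (by rw [h, one_pow])
  have hx : (p : ℤ_[p]) ∣ x := by simpa [hUσ] using hU01 σ
  have hgen := hσ.eq_top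
  constructor
  · refine delta_eq_zero hpl ?_
    have hD1 := fun i j => dvd_apply_sub_of_redGL_eq hD i j
    have := t1Space_quotient (isClosed_latT' (p := p))
    refine H1nr_eq_bot_of_unit (e := coords D) (σ := σ) (τ := τ)
      (π := (repV (twist ρ β)).comp (decomp ι)) hgen ?_ (fun _ _ => rfl)
      (coords_mem_latT'_iff (hD1 1 0) (hD1 1 1)) ω hω
      (fun i hi => ⟨_, hU01 i, hactI i hi⟩) hq hactσ hτ.1 hy hy2 hactτ
    intro m
    obtain ⟨v, rfl⟩ := (latT' p).mkQ_surjective m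
    exact (latT' p).isOpenQuotientMap_mkQ.continuous.comp (hcontV v)
  · intro hβ1
    have hω1 : ∀ g, ω g = 1 := fun g => by
      change ((teichLift β (decomp ι g))⁻¹ : ℤ_[p]ˣ).1 = 1
      rw [teichLift_eq_one (hβ1 g), inv_one, Units.val_one]
    simp only [hω1, PadicInt.coe_one, one_mul] at hact hactI hactσ hactτ
    have hL := coords_mem_latT_iff (p := p) D
    constructor
    · have := t1Space_quotient (isClosed_latT (p := p))
      have hI : ∀ i ∈ inertia ℓ, ∃ z : ℤ_[p], ∀ a b,
          repV (twist ρ β) (decomp ι i) (coords D (a, b)) = coords D (a + z * b, b) :=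
        fun i hi => ⟨_, hactI i hi⟩
      have hcont : ∀ m, Continuous fun g =>
          locA ι (repV (twist ρ β)) (latT p) (latT_stable (twist ρ β)) g m := by
        intro m
        obtain ⟨v, rfl⟩ := (latT p).mkQ_surjective m
        exact (latT p).isOpenQuotientMap_mkQ.continuous.comp (hcontV v)
      have hG : ∀ g b, ‖(p : ℚ_[p]) * b‖ ≤ 1 →
          repV (twist ρ β) (decomp ι g) (coords D (0, b)) - coords D (0, b) ∈ latT p := by
        intro g b hb
        rw [hact, ← map_sub, Prod.mk_sub_mk, hL, mul_zero, zero_add, sub_zero, mul_zero, zero_add]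
        refine ⟨norm_mul_le_one_of_dvd (hU01 g) hb, ?_⟩
        have h1 := norm_mul_le_one_of_dvd (redGL_one_apply (hUred g) 1 1) hb
        have h2 : ((U g).1 1 1 : ℚ_[p]) * b - b = (((U g).1 1 1 - 1 : ℤ_[p]) : ℚ_[p]) * b := by
          push_cast; ring
        rwa [h2]
      -- The determinant serves as the unramified character `≡ 1` mod `p`: it is trivial on
      -- unipotent inertia and equals `ℓ` at `σ`, with `p² ∤ ℓ - 1`.
      let d : GalQl ℓ →* ℤ_[p] :=
        (Matrix.detMonoidHom).comp ((Units.coeHom (Matrix (Fin 2) (Fin 2) ℤ_[p])).comp U)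
      have hd0 : ∀ g, d g = (U g).1 0 0 * (U g).1 1 1 - (U g).1 0 1 * (U g).1 1 0 := fun g =>
        Matrix.det_fin_two _
      have hd : Continuous d := (Units.continuous_val.comp hU).matrix_det
      have hd1 : ∀ g, (p : ℤ_[p]) ∣ d g - 1 := fun g => by
        have h00 := redGL_one_apply (hUred g) 0 0
        have h11 := redGL_one_apply (hUred g) 1 1
        have : d g - 1 = ((U g).1 0 0 - 1) * (U g).1 1 1 + ((U g).1 1 1 - 1) -
          (U g).1 0 1 * (U g).1 1 0 := by rw [hd0]; ring
        rw [this]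
        exact dvd_sub (dvd_add (h00.mul_right _) h11) ((hU01 g).mul_right _)
      have hdI : ∀ i ∈ inertia ℓ, d i = 1 := fun i hi => by
        rw [hd0, hUI i hi]; simp
      have hdσ : ¬ (p : ℤ_[p]) ^ 2 ∣ d σ - 1 := by
        have : d σ = ℓ := by rw [hd0, hUσ]; simp
        rw [this]
        exact not_sq_dvd_natCast_sub_one hℓ2
      have hπ : ∀ g v, locA ι (repV (twist ρ β)) (latT p) (latT_stable (twist ρ β)) g
          ((latT p).mkQ v) = (latT p).mkQ (locV ι (repV (twist ρ β)) g v) := fun _ _ => rfl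
      let c := characterCocycle hπ hL (continuous_coords D) hG d hd hd1
      refine delta_eq_one hpl
        (H1nr_vectorSpace_eq_bot (e := coords D) hgen hcontV hI hq1 hactσ hτ.1
          (y := y) (by rintro rfl; exact hy2 (dvd_zero _)) hactτ)
        (x := Submodule.Quotient.mk c) (mk_mem_H1nr fun i hi => ?_)
        (characterCocycle_mk_ne_zero hπ hL _ hG d hd hd1 hdσ hactσ) ?_ fun X hX =>
          exists_eq_nsmul_characterCocycle hgen hcont hπ hL _ hG d hd hd1 hdI hdσ hI hq1 hactσ
            hτ.1 hy hy2 hactτ hX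
      · change (latT p).mkQ (coords D (0, ((d i : ℚ_[p]) - 1) / p ^ 2)) = 0
        rw [hdI _ hi, PadicInt.coe_one, sub_self, zero_div]
        exact (congrArg _ (map_zero (coords D))).trans (map_zero _)
      · exact (congrArg Submodule.Quotient.mk
          (nsmul_characterCocycle hπ hL (continuous_coords D) hG d hd hd1))
    · exact finite_invariants (e := coords D) (π := (repV (twist ρ β)).comp (decomp ι))
        (fun _ _ => rfl) hL (natCast_dvd_sub_one hℓ1) (not_sq_dvd_natCast_sub_one hℓ2) hx hactσ
        hy hy2 hactτ
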